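/- **Proposition.** For every integer $b\ge 1$ there exists a finite connected flag simplicial $3$-manifold $\Delta$ (without boundary) with $\beta_1(\Delta)=b$ and $\gamma_2(\Delta)=16b$. Here a simplicial complex is *flag* if each of its minimal non-faces has exactly two vertices; a *simplicial $3$-manifold* is a $3$-dimensional simplicial complex whose geometric realization is a (topological) $3$-manifold; $\gamma_2(\Delta)=f_1(\Delta)-5f_0(\Delta)+16$, where $f_i(\Delta)$ is the number of $i$-dimensional faces of $\Delta$; and $\beta_1(\Delta)$ is the rank of the first simplicial homology of $\Delta$. One and the same $\Delta$ has $\beta_1(\Delta)=b$ with coefficients in $\mathbb Z$ and in every field. -/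

import Mathlib

namespace AbstractSimplicialComplex

/-- The geometric realization of a simplicial complex on a finite vertex set `V`, in barycentric
coordinates, with the subspace topology of `V → ℝ`: the points `x` with nonnegative coordinates
that sum to one, whose support is a face. -/
def realization {V : Type*} [Fintype V] (K : AbstractSimplicialComplex V) : Set (V → ℝ) :=
  {x | (∀ v, 0 ≤ x v) ∧ ∑ v, x v = 1 ∧ ∃ s ∈ K.faces, ∀ v, v ∈ s ↔ x v ≠ 0}

/-- A missing face (minimal non-face): a set of vertices that is not a face, all of whose proper
subsets are faces. (In `AbstractSimplicialComplex` the empty face is not recorded.) -/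
def IsMissingFace {V : Type*} (K : AbstractSimplicialComplex V) (s : Finset V) : Prop :=
  s.Nonempty ∧ s ∉ K.faces ∧ ∀ t, t ⊂ s → t.Nonempty → t ∈ K.faces

/-- A complex is flag if all its missing faces have two elements. -/
def IsFlag {V : Type*} (K : AbstractSimplicialComplex V) : Prop :=
  ∀ s, K.IsMissingFace s → s.card = 2

/-- The `i`-dimensional faces. -/
abbrev Simplex {V : Type*} (K : AbstractSimplicialComplex V) (i : ℕ) : Type _ :=
  {s : Finset V // s ∈ K.faces ∧ s.card = i + 1}

/-- The number `f_i` of `i`-dimensional faces. -/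
noncomputable def fNumber {V : Type*} (K : AbstractSimplicialComplex V) (i : ℕ) : ℕ :=
  Nat.card (K.Simplex i)

/-- `γ₂ = f₁ - 5 f₀ + 16`. -/
noncomputable def gammaTwo {V : Type*} (K : AbstractSimplicialComplex V) : ℤ :=
  (K.fNumber 1 : ℤ) - 5 * (K.fNumber 0 : ℤ) + 16

/-- The complex has dimension `d`: it has a `d`-dimensional face and none of higher dimension. -/
def HasDimension {V : Type*} (K : AbstractSimplicialComplex V) (d : ℕ) : Prop :=
  (∃ s ∈ K.faces, s.card = d + 1) ∧ ∀ s ∈ K.faces, s.card ≤ d + 1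

/-- A simplicial `d`-manifold (without boundary): a `d`-dimensional complex whose geometric
realization is locally homeomorphic to `ℝ^d`. Compactness, the Hausdorff property and second
countability are automatic for the realization of a finite complex. -/
def IsSimplicialManifold {V : Type*} [Fintype V] (K : AbstractSimplicialComplex V) (d : ℕ) :
    Prop :=
  K.HasDimension d ∧ Nonempty (ChartedSpace (EuclideanSpace ℝ (Fin d)) K.realization)

/-- The face of an `(i+1)`-simplex obtained by deleting one of its vertices. -/
def Simplex.delete {V : Type*} [DecidableEq V] {K : AbstractSimplicialComplex V} {i : ℕ}
    (σ : K.Simplex (i + 1)) (v : {v : V // v ∈ σ.1}) : K.Simplex i :=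
  ⟨σ.1.erase v.1, by
    have hc : (σ.1.erase v.1).card = i + 1 := by
      rw [Finset.card_erase_of_mem v.2, σ.2.2]; rfl
    exact ⟨(K.isRelLowerSet_faces σ.2.1).2 (Finset.erase_subset _ _)
      (Finset.card_pos.mp (by omega)), hc⟩⟩

/-- The simplicial boundary map `∂ : C_{i+1}(K; R) → C_i(K; R)`, where simplices are oriented by a
linear order on the vertices: for `v₀ < ⋯ < v_{i+1}` the simplex `{v₀, …, v_{i+1}}` is sent to
`∑ j, (-1)^j {v₀, …, v_{i+1}} \ {v_j}`. -/
noncomputable def boundary (R : Type*) [CommRing R] {V : Type*} [LinearOrder V]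
    (K : AbstractSimplicialComplex V) (i : ℕ) :
    (K.Simplex (i + 1) →₀ R) →ₗ[R] (K.Simplex i →₀ R) :=
  Finsupp.linearCombination R fun σ : K.Simplex (i + 1) =>
    ∑ v : {v : V // v ∈ σ.1},
      Finsupp.single (σ.delete v) ((-1 : R) ^ (σ.1.filter (fun w => w < v.1)).card)

/-- The simplicial `i`-cycles; every `0`-chain is a cycle. -/
noncomputable def cycles (R : Type*) [CommRing R] {V : Type*} [LinearOrder V]
    (K : AbstractSimplicialComplex V) : (i : ℕ) → Submodule R (K.Simplex i →₀ R)
  | 0 => ⊤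
  | i + 1 => LinearMap.ker (K.boundary R i)

/-- The rank of the quotient `Z / (B ∩ Z)` for submodules `Z`, `B` of a module. -/
noncomputable def subquotientRank (R : Type*) [CommRing R] {M : Type*} [AddCommGroup M]
    [Module R M] (Z B : Submodule R M) : ℕ :=
  Module.finrank R (Z ⧸ B.submoduleOf Z)

/-- The `i`-th Betti number with coefficients in `R`: the rank of the simplicial homology module
`H_i(K; R)`, the quotient of the `i`-cycles by the `i`-boundaries (which are cycles). -/
noncomputable def bettiNumber (R : Type*) [CommRing R] {V : Type*} [LinearOrder V]
    (K : AbstractSimplicialComplex V) (i : ℕ) : ℕ :=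
  subquotientRank R (K.cycles R i) (LinearMap.range (K.boundary R i))

end AbstractSimplicialComplex

/-!
The manifolds are clique complexes of graphs, so that flagness is automatic (`isFlag_cliqueComplex`)
and `f₀`, `f₁` are the numbers of vertices and edges of the graph.

*The graphs.* Place octahedra on a stack by replacing one vertex at a time, running cyclically
through the six vertices in an order in which antipodes are three steps apart. Each new vertex is
joined to the one that it replaces and to its four neighbours, so two vertices are adjacent exactly
if their distance in the order is 1, 2, 4, 5 or 6. Closing up the stack after 32 steps gives an
`S²`-bundle over the circle with `f₁ = 5 f₀` (`stackGraph`); this settles `b = 1`. The open star of an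
edge between vertices at distance 6 is a solid octahedron. Removing two of these stars and joining
their boundaries by another stack of octahedra, the tube, costs 2 edges and adds 18, and no vertex:
`handleGraph` has `f₁ = 5 f₀ + 16`, and its fundamental group is free of rank two, generated by a loop
around the stack and one through the tube. The `d`-fold cyclic covering that unwinds the first of
them has `f₁ - 5 f₀ = 16 d` and `β₁ = d + 1`, which gives all `b = d + 1 ≥ 2`.

*Manifold.* The open star of a vertex is the cone over its link
(`nonempty_openStar_homeomorph`), and links do not change under coverings. If a flag complex arises
from another one by subdividing the edge `uw` with a new vertex `p`, the cones over the two are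
homeomorphic: in one direction the coordinate of `p` is added to those of `u` and `w`, in the other
it is their minimum (`IsEdgeSubdivision.nonempty_homeomorph`). Each link in the two graphs reduces in
this way to the boundary of an octahedron, the cone over which is `ℝ³`, with coordinates the
differences of those of antipodes. The reduction is found by a greedy search, which is evaluated in
the kernel (`reducesToOctahedron_link_handleAdj`).

*Homology.* The coverings have a hamiltonian cycle `p`, lifted from the cycle around the stack, and
one chord through each of the `d` tubes; every other edge is the third side of a triangle whose other
sides have been reached before. Hence each edge `uv` is, modulo boundaries, the difference of the paths
along `p` to its end points plus a combination of the loops given by `p` and by the chords. Explicit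
integral cocycles compute the coefficients and are dual to these loops, so that the first homology is
free on them over every nontrivial ring (`bettiNumber_one_of_hamiltonianCycle`).
-/

/-! ### Cones over flag complexes and their homeomorphism types -/

/-- The cone over the clique complex of the graph `R` on the vertices listed in `S`: nonnegative
coordinate vectors, supported on `S`, whose support is a clique of `R`. -/
def cliqueCone {W : Type*} (S : List W) (R : W → W → Bool) : Set (W → ℝ) :=
  {t | (∀ v, 0 ≤ t v) ∧ (∀ v, t v ≠ 0 → v ∈ S) ∧ ∀ u w, t u ≠ 0 → t w ≠ 0 → u ≠ w → R u w = true}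

/-- The graph `R` with the edge `uw` added. -/
def addEdge {W : Type*} [DecidableEq W] (R : W → W → Bool) (u w : W) : W → W → Bool :=
  fun x y => R x y || (x == u && y == w) || (x == w && y == u)

/-- The clique complex of `R` on `S` is the subdivision, with new vertex `p`, of the edge `uw` of
the clique complex of `addEdge R u w` on `S \ {p}`. -/
structure IsEdgeSubdivision {W : Type*} (S : List W) (R : W → W → Bool) (p u w : W) : Prop where
  ne : u ≠ w
  not_adj : R u w = false
  mem : p ∈ S
  mem_left : u ∈ S
  mem_right : w ∈ S
  adj_left : R p u = true
  adj_right : R p w = true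
  adj_iff : ∀ q ∈ S, q ≠ p → q ≠ u → q ≠ w → R p q = (R u q && R w q)

/-- Undoing the subdivision of an edge `uw` with new vertex `p` is a homeomorphism of cones: the
coordinate of `p` is added to those of `u` and `w`, and it is recovered as their minimum. -/
theorem IsEdgeSubdivision.nonempty_homeomorph {W : Type*} [DecidableEq W] {S : List W}
    {R : W → W → Bool} {p u w : W} (h : IsEdgeSubdivision S R p u w)
    (hs : ∀ x y, R x y = R y x) (hi : ∀ x, R x x = false) :
    Nonempty (cliqueCone S R ≃ₜ cliqueCone (S.filter (· != p)) (addEdge R u w)) := by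
  obtain ⟨huw, hR, hp, hu, hw, hpu, hpw, hq⟩ := h
  have hpu' : p ≠ u := by rintro rfl; simp [hi] at hpu
  have hpw' : p ≠ w := by rintro rfl; simp [hi] at hpw
  let f : (W → ℝ) → (W → ℝ) := fun t v =>
    if v = p then 0 else if v = u ∨ v = w then t v + t p else t v
  let g : (W → ℝ) → (W → ℝ) := fun t v =>
    if v = p then min (t u) (t w) else if v = u ∨ v = w then t v - min (t u) (t w) else t v
  have hf : ∀ t ∈ cliqueCone S R, f t ∈ cliqueCone (S.filter (· != p)) (addEdge R u w) := by
    rintro t ⟨h0, hS, hc⟩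
    refine ⟨fun v => ?_, fun v hv => ?_, fun x y hx hy hxy => ?_⟩
    · simp only [f]; split_ifs
      · exact le_rfl
      · exact add_nonneg (h0 _) (h0 _)
      · exact h0 _
    · by_cases hvp : v = p
      · simp [f, hvp] at hv
      · simp only [List.mem_filter, bne_iff_ne, ne_eq, hvp, not_false_eq_true, and_true]
        simp only [f, hvp, if_false] at hv
        split_ifs at hv with h1
        · rcases h1 with rfl | rfl <;> assumption
        · exact hS _ hv
    · have hxp : x ≠ p := by rintro rfl; simp [f] at hx
      have hyp : y ≠ p := by rintro rfl; simp [f] at hy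
      simp only [f, hxp, hyp, if_false] at hx hy
      simp only [addEdge, Bool.or_eq_true, Bool.and_eq_true, beq_iff_eq]
      by_cases hx1 : x = u ∨ x = w <;> by_cases hy1 : y = u ∨ y = w
      · rcases hx1 with rfl | rfl <;> rcases hy1 with rfl | rfl <;> simp_all
      · simp only [hx1, hy1, if_true, if_false] at hx hy
        rw [not_or] at hy1
        left; left
        by_cases htp : t p = 0
        · exact hc _ _ (by simpa [htp] using hx) hy hxy
        · have h1 := hc p y htp hy hyp.symm
          rw [hq y (hS _ hy) hyp hy1.1 hy1.2, Bool.and_eq_true] at h1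
          rcases hx1 with rfl | rfl
          exacts [h1.1, h1.2]
      · simp only [hx1, hy1, if_true, if_false] at hx hy
        rw [not_or] at hx1
        left; left
        by_cases htp : t p = 0
        · exact hc _ _ hx (by simpa [htp] using hy) hxy
        · have h1 := hc p x htp hx hxp.symm
          rw [hq x (hS _ hx) hxp hx1.1 hx1.2, Bool.and_eq_true] at h1
          rw [hs]
          rcases hy1 with rfl | rfl
          exacts [h1.1, h1.2]
      · simp only [hx1, hy1, if_false] at hx hy
        exact Or.inl (Or.inl (hc _ _ hx hy hxy))
  have hg : ∀ t ∈ cliqueCone (S.filter (· != p)) (addEdge R u w), g t ∈ cliqueCone S R := by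
    rintro t ⟨h0, hS, hc⟩
    have htp : t p = 0 := by
      by_contra h; simpa using hS p h
    have hm : min (t u) (t w) ≠ 0 → t u ≠ 0 ∧ t w ≠ 0 := fun h => by
      constructor <;> intro h' <;> simp [h', h0] at h
    -- A vertex keeps a nonzero coordinate only if it had one before; `u` and `w` do not both.
    have hsupp : ∀ v, v ≠ p → g t v ≠ 0 → t v ≠ 0 := by
      intro v hv hv' h
      simp only [g, hv, if_false] at hv'
      split_ifs at hv' with h1
      · rcases h1 with rfl | rfl <;> simp [h, h0] at hv'
      · exact hv' h
    have hnot : g t u = 0 ∨ g t w = 0 := by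
      simp only [g, hpu'.symm, hpw'.symm, if_false, true_or, or_true, if_true]
      rcases le_total (t u) (t w) with h | h
      · left; simp [h]
      · right; simp [h]
    -- The vertex `p` is adjacent to every vertex of the new support.
    have hpadj : ∀ y, y ≠ p → g t p ≠ 0 → g t y ≠ 0 → R p y = true := by
      intro y hyp h1 hy
      simp only [g, if_true] at h1
      obtain ⟨h2, h3⟩ := hm h1
      by_cases hyu : y = u
      · rwa [hyu]
      by_cases hyw : y = w
      · rwa [hyw]
      have hy' := hsupp y hyp hy
      have h4 := hc u y h2 hy' (Ne.symm hyu)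
      have h5 := hc w y h3 hy' (Ne.symm hyw)
      have hyS : y ∈ S := (List.mem_filter.1 (hS y hy')).1
      rw [hq y hyS hyp hyu hyw]
      simp only [addEdge, Bool.or_eq_true, Bool.and_eq_true, beq_iff_eq] at h4 h5 ⊢
      simp_all
    refine ⟨fun v => ?_, fun v hv => ?_, fun x y hx hy hxy => ?_⟩
    · simp only [g]; split_ifs with h1 h2
      · exact le_min (h0 _) (h0 _)
      · rcases h2 with rfl | rfl <;> simp
      · exact h0 _
    · by_cases hvp : v = p
      · rwa [hvp]
      · exact (List.mem_filter.1 (hS v (hsupp v hvp hv))).1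
    · by_cases hxp : x = p
      · subst hxp; exact hpadj y hxy.symm hx hy
      by_cases hyp : y = p
      · subst hyp; rw [hs]; exact hpadj x hxy hy hx
      have h4 := hc x y (hsupp x hxp hx) (hsupp y hyp hy) hxy
      simp only [addEdge, Bool.or_eq_true, Bool.and_eq_true, beq_iff_eq] at h4
      rcases h4 with (h4 | ⟨rfl, rfl⟩) | ⟨rfl, rfl⟩
      · exact h4
      · exact absurd hnot (not_or.2 ⟨hx, hy⟩)
      · exact absurd hnot (not_or.2 ⟨hy, hx⟩)
  have hgf : ∀ t ∈ cliqueCone S R, g (f t) = t := by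
    rintro t ⟨h0, hS, hc⟩
    have h1 : min (t u) (t w) = 0 := by
      by_cases h2 : t u = 0
      · simp [h2, h0]
      by_cases h3 : t w = 0
      · simp [h3, h0]
      exact absurd (hc u w h2 h3 huw) (by simp [hR])
    have h2 : min (f t u) (f t w) = t p := by
      simp only [f, hpu'.symm, hpw'.symm, if_false, true_or, or_true, if_true]
      rw [min_add_add_right, h1, zero_add]
    funext v
    simp only [g, h2]
    split_ifs with h3 h4
    · rw [h3]
    · simp [f, h3, h4]
    · simp [f, h3, h4]
  have hfg : ∀ t ∈ cliqueCone (S.filter (· != p)) (addEdge R u w), f (g t) = t := by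
    rintro t ⟨h0, hS, hc⟩
    have htp : t p = 0 := by
      by_contra h; simpa using hS p h
    funext v
    simp only [f]
    split_ifs with h3 h4
    · rw [h3, htp]
    · simp [g, h3, h4]
    · simp [g, h3, h4]
  have hfc : Continuous f := by
    refine continuous_pi fun v => ?_
    simp only [f]
    split_ifs <;> fun_prop
  have hgc : Continuous g := by
    refine continuous_pi fun v => ?_
    simp only [g]
    split_ifs <;> fun_prop
  exact ⟨{ toFun := fun t => ⟨f t.1, hf _ t.2⟩
           invFun := fun t => ⟨g t.1, hg _ t.2⟩
           left_inv := fun t => Subtype.ext (hgf _ t.2)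
           right_inv := fun t => Subtype.ext (hfg _ t.2)
           continuous_toFun := by fun_prop
           continuous_invFun := by fun_prop }⟩

theorem addEdge_symm {W : Type*} [DecidableEq W] {R : W → W → Bool} (hs : ∀ x y, R x y = R y x)
    (u w : W) (x y : W) : addEdge R u w x y = addEdge R u w y x := by
  simp only [addEdge, hs x y]
  cases R y x <;> simp [Bool.or_comm, Bool.and_comm]

theorem addEdge_self {W : Type*} [DecidableEq W] {R : W → W → Bool} (hi : ∀ x, R x x = false)
    {u w : W} (h : u ≠ w) (x : W) : addEdge R u w x x = false := by
  simp only [addEdge, hi, Bool.false_or, Bool.or_eq_false_iff, Bool.and_eq_false_iff,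
    beq_eq_false_iff_ne]
  by_cases hx : x = u
  · subst hx; exact ⟨Or.inr h, Or.inl h⟩
  · exact ⟨Or.inl hx, Or.inr hx⟩

/-- The cone over the suspension of a flag complex is the product of the line with its cone. -/
theorem nonempty_homeomorph_suspension {W : Type*} [DecidableEq W] {S S' : List W}
    {R : W → W → Bool} {a a' : W} (hs : ∀ x y, R x y = R y x) (haa : a ≠ a')
    (hR : R a a' = false) (hS : ∀ x, x ∈ S ↔ x = a ∨ x = a' ∨ x ∈ S')
    (ha : a ∉ S') (ha' : a' ∉ S') (h1 : ∀ x ∈ S', R a x = true) (h2 : ∀ x ∈ S', R a' x = true) :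
    Nonempty (cliqueCone S R ≃ₜ ℝ × cliqueCone S' R) := by
  let f : (W → ℝ) → (W → ℝ) := fun t v => if v = a ∨ v = a' then 0 else t v
  let g : ℝ → (W → ℝ) → (W → ℝ) := fun y t v =>
    if v = a then max y 0 else if v = a' then max (-y) 0 else t v
  have hf : ∀ t ∈ cliqueCone S R, f t ∈ cliqueCone S' R := by
    rintro t ⟨h0, hS', hc⟩
    have hne : ∀ v, f t v ≠ 0 → v ≠ a ∧ v ≠ a' ∧ t v ≠ 0 := by
      intro v hv
      simp only [f] at hv
      split_ifs at hv with h
      · exact absurd rfl hv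
      · rw [not_or] at h
        exact ⟨h.1, h.2, hv⟩
    refine ⟨fun v => ?_, fun v hv => ?_, fun x y hx hy hxy =>
      hc x y (hne x hx).2.2 (hne y hy).2.2 hxy⟩
    · simp only [f]; split_ifs
      exacts [le_rfl, h0 v]
    · obtain ⟨h3, h4, h5⟩ := hne v hv
      have := (hS v).1 (hS' v h5)
      tauto
  have hg : ∀ y, ∀ t ∈ cliqueCone S' R, g y t ∈ cliqueCone S R := by
    rintro y t ⟨h0, hS', hc⟩
    refine ⟨fun v => ?_, fun v hv => ?_, fun x z hx hz hxz => ?_⟩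
    · simp only [g]; split_ifs
      exacts [le_max_right _ _, le_max_right _ _, h0 v]
    · rw [hS]
      by_cases h3 : v = a
      · exact Or.inl h3
      by_cases h4 : v = a'
      · exact Or.inr (Or.inl h4)
      simp only [g, h3, h4, if_false] at hv
      exact Or.inr (Or.inr (hS' v hv))
    · have hmem : ∀ v, v ≠ a → v ≠ a' → g y t v ≠ 0 → v ∈ S' ∧ t v ≠ 0 := by
        intro v h3 h4 hv
        simp only [g, h3, h4, if_false] at hv
        exact ⟨hS' v hv, hv⟩
      have hnot : g y t a = 0 ∨ g y t a' = 0 := by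
        simp only [g, if_true, haa.symm, if_false]
        rcases le_total y 0 with h | h
        · left; simp [h]
        · right; simp [h]
      by_cases hxa : x = a
      · subst hxa
        by_cases hza : z = a'
        · subst hza; exact absurd hnot (not_or.2 ⟨hx, hz⟩)
        · exact h1 z (hmem z hxz.symm hza hz).1
      by_cases hxa' : x = a'
      · subst hxa'
        by_cases hza : z = a
        · subst hza; exact absurd hnot (not_or.2 ⟨hz, hx⟩)
        · exact h2 z (hmem z hza hxz.symm hz).1
      by_cases hza : z = a
      · subst hza; rw [hs]; exact h1 x (hmem x hxa hxa' hx).1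
      by_cases hza' : z = a'
      · subst hza'; rw [hs]; exact h2 x (hmem x hxa hxa' hx).1
      exact hc x z (hmem x hxa hxa' hx).2 (hmem z hza hza' hz).2 hxz
  have hgf : ∀ t ∈ cliqueCone S R, g (t a - t a') (f t) = t := by
    rintro t ⟨h0, hS', hc⟩
    have h3 : t a = 0 ∨ t a' = 0 := by
      by_contra! h
      exact absurd (hc a a' h.1 h.2 haa) (by simp [hR])
    funext v
    simp only [g, f]
    split_ifs with h4 h5 h6
    · subst h4; rcases h3 with h3 | h3 <;> simp [h3, h0]
    · subst h5; rcases h3 with h3 | h3 <;> simp [h3, h0]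
    · exact absurd h6 (not_or.2 ⟨h4, h5⟩)
    · rfl
  have hfg : ∀ y, ∀ t ∈ cliqueCone S' R, f (g y t) = t := by
    rintro y t ⟨h0, hS', hc⟩
    have h3 : ∀ v, v ∉ S' → t v = 0 := fun v hv => by
      by_contra h; exact hv (hS' v h)
    funext v
    simp only [f]
    split_ifs with h4
    · rcases h4 with rfl | rfl
      exacts [(h3 _ ha).symm, (h3 _ ha').symm]
    · rw [not_or] at h4
      simp [g, h4.1, h4.2]
  have hgy : ∀ y t, g y t a - g y t a' = y := by
    intro y t
    simp only [g, if_true, haa.symm, if_false]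
    rcases le_total y 0 with h | h <;> simp [h]
  have hfc : Continuous f := by
    refine continuous_pi fun v => ?_
    simp only [f]
    split_ifs <;> fun_prop
  have hgc : Continuous fun x : ℝ × (W → ℝ) => g x.1 x.2 := by
    refine continuous_pi fun v => ?_
    simp only [g]
    split_ifs <;> fun_prop
  exact ⟨{ toFun := fun t => (t.1 a - t.1 a', ⟨f t.1, hf _ t.2⟩)
           invFun := fun x => ⟨g x.1 x.2.1, hg _ _ x.2.2⟩
           left_inv := fun t => Subtype.ext (hgf _ t.2)
           right_inv := fun x => Prod.ext (hgy _ _) (Subtype.ext (hfg _ _ x.2.2))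
           continuous_toFun := by
            have h3 := hfc.comp (continuous_subtype_val (p := (· ∈ cliqueCone S R)))
            exact Continuous.prodMk (((continuous_apply a).comp continuous_subtype_val).sub
              ((continuous_apply a').comp continuous_subtype_val)) (h3.subtype_mk _)
           continuous_invFun :=
            (hgc.comp (continuous_fst.prodMk (continuous_subtype_val.comp continuous_snd))).subtype_mk
              _ }⟩

/-- A test that the graph `R` on `S` is the `n`-fold suspension of the empty graph, that is, the
graph of the cross-polytope with `2n` vertices. -/
def isCrossPolytope {W : Type*} [DecidableEq W] (R : W → W → Bool) : ℕ → List W → Bool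
  | 0, S => S.isEmpty
  | _ + 1, [] => false
  | n + 1, a :: S => match S.filter (fun x => !R a x) with
    | [b] => a != b && (S.filter (R a)).all (R b) && isCrossPolytope R n (S.filter (R a))
    | _ => false

theorem nonempty_homeomorph_of_isCrossPolytope {W : Type*} [DecidableEq W] {R : W → W → Bool}
    (hs : ∀ x y, R x y = R y x) (hi : ∀ x, R x x = false) (n : ℕ) (S : List W)
    (h : isCrossPolytope R n S = true) : Nonempty (cliqueCone S R ≃ₜ (Fin n → ℝ)) := by
  induction n generalizing S with
  | zero =>
    simp only [isCrossPolytope, List.isEmpty_iff] at h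
    subst h
    have hz : ∀ t ∈ cliqueCone ([] : List W) R, t = 0 := by
      rintro t ⟨-, ht, -⟩
      funext v
      by_contra hv
      simpa using ht v hv
    have h0 : (0 : W → ℝ) ∈ cliqueCone ([] : List W) R := ⟨by simp, by simp, by simp⟩
    exact ⟨{ toFun := fun _ => 0
             invFun := fun _ => ⟨0, h0⟩
             left_inv := fun t => Subtype.ext (hz _ t.2).symm
             right_inv := fun _ => Subsingleton.elim _ _
             continuous_toFun := continuous_const
             continuous_invFun := continuous_const }⟩
  | succ n ih =>
    cases S with
    | nil => simp [isCrossPolytope] at h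
    | cons a S =>
      simp only [isCrossPolytope] at h
      split at h
      · rename_i b hb
        simp only [Bool.and_eq_true, bne_iff_ne, ne_eq, List.all_eq_true] at h
        obtain ⟨⟨hab, hall⟩, hrec⟩ := h
        have hmem : ∀ x, x ∈ S ∧ R a x = false ↔ x = b := by
          intro x
          have : x ∈ S.filter (fun x => !R a x) ↔ x ∈ [b] := by rw [hb]
          simpa using this
        have hRb : R a b = false := ((hmem b).2 rfl).2
        obtain ⟨e⟩ := ih _ hrec
        obtain ⟨e'⟩ := nonempty_homeomorph_suspension (S := a :: S) (S' := S.filter (R a)) hs hab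
          hRb (fun x => by
            have := hmem x
            have := hmem b
            cases hx : R a x <;> simp_all) (by simp [hi]) (by simp [hRb])
          (fun x hx => (List.mem_filter.1 hx).2) hall
        let c : (ℝ × (Fin n → ℝ)) ≃ₜ (Fin (n + 1) → ℝ) :=
          { toEquiv := Fin.consEquiv (fun _ => ℝ)
            continuous_toFun := by
              refine continuous_pi fun i => ?_
              refine Fin.cases ?_ (fun j => ?_) i
              · simpa [Fin.consEquiv] using continuous_fst
              · simp only [Fin.consEquiv, Equiv.toFun_as_coe, Equiv.coe_fn_mk, Fin.cons_succ]
                fun_prop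
            continuous_invFun := by
              simp only [Fin.consEquiv]
              fun_prop }
        exact ⟨(e'.trans ((Homeomorph.refl ℝ).prodCongr e)).trans c⟩
      · simp at h

/-- A test for `IsEdgeSubdivision`, restricted to new vertices of degree four. -/
def isEdgeSubdivision {W : Type*} [DecidableEq W] (S : List W) (R : W → W → Bool)
    (x : W × W × W) : Bool :=
  x.2.1 != x.2.2 && !R x.2.1 x.2.2 &&
    S.all fun q => q == x.1 || q == x.2.1 || q == x.2.2 || R x.1 q == (R x.2.1 q && R x.2.2 q)

/-- The triples `(p, u, w)` for which `p` is a vertex of degree four and `u`, `w` are adjacent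
to it. -/
def subdivisionCandidates {W : Type*} (S : List W) (R : W → W → Bool) : List (W × W × W) :=
  (S.filter fun p => (S.filter (R p)).length == 4).flatMap fun p =>
    (S.filter (R p)).flatMap fun u => (S.filter (R p)).map fun w => (p, u, w)

/-- A test that at most `n` subdivided edges can be found, one after the other, whose contraction
turns the clique complex of the graph `R` on `S` into the boundary of an octahedron. -/
def reducesToOctahedron {W : Type*} [DecidableEq W] : ℕ → List W → (W → W → Bool) → Bool
  | 0, S, R => isCrossPolytope R 3 S
  | n + 1, S, R => match (subdivisionCandidates S R).find? (isEdgeSubdivision S R) with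
    | none => isCrossPolytope R 3 S
    | some x => reducesToOctahedron n (S.filter (· != x.1)) (addEdge R x.2.1 x.2.2)

/-- If a flag 2-sphere reduces to the octahedron by undoing edge subdivisions, then the cone over it
is a euclidean space. -/
theorem nonempty_homeomorph_of_reducesToOctahedron {W : Type*} [DecidableEq W] (n : ℕ)
    (S : List W) (R : W → W → Bool) (hs : ∀ x y, R x y = R y x) (hi : ∀ x, R x x = false)
    (h : reducesToOctahedron n S R = true) : Nonempty (cliqueCone S R ≃ₜ (Fin 3 → ℝ)) := by
  induction n generalizing S R with
  | zero => exact nonempty_homeomorph_of_isCrossPolytope hs hi 3 S h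
  | succ n ih =>
    simp only [reducesToOctahedron] at h
    split at h
    · exact nonempty_homeomorph_of_isCrossPolytope hs hi 3 S h
    · rename_i x hx
      have h1 := List.find?_some hx
      have h2 := List.mem_of_find?_eq_some hx
      obtain ⟨p, u, w⟩ := x
      simp only [isEdgeSubdivision, Bool.and_eq_true, bne_iff_ne, ne_eq, Bool.not_eq_true',
        List.all_eq_true, Bool.or_eq_true, beq_iff_eq] at h1
      obtain ⟨⟨h3, h4⟩, h5⟩ := h1
      simp only [subdivisionCandidates, List.mem_flatMap, List.mem_map, List.mem_filter,
        Prod.mk.injEq] at h2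
      obtain ⟨_, ⟨hp, -⟩, _, ⟨hu, hpu⟩, _, ⟨hw, hpw⟩, rfl, rfl, rfl⟩ := h2
      have hsub : IsEdgeSubdivision S R _ _ _ := ⟨h3, h4, hp, hu, hw, hpu, hpw, fun q hq h6 h7 h8 => by
        have := h5 q hq
        tauto⟩
      obtain ⟨e⟩ := hsub.nonempty_homeomorph hs hi
      obtain ⟨e'⟩ := ih _ _ (addEdge_symm hs _ _) (addEdge_self hi h3) h
      exact ⟨e.trans e'⟩

/-! ### Flag complexes: manifold charts, connectedness and face numbers -/

/-- The clique complex of a graph: its faces are the nonempty cliques. -/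
def cliqueComplex {V : Type*} (G : SimpleGraph V) : AbstractSimplicialComplex V where
  faces := {s | s.Nonempty ∧ G.IsClique s}
  isRelLowerSet_faces := fun _ hs => ⟨hs.1, fun _ ht hne => ⟨hne, hs.2.subset ht⟩⟩
  singleton_mem := fun v => ⟨Finset.singleton_nonempty v, by simp⟩

theorem mem_faces_cliqueComplex {V : Type*} {G : SimpleGraph V} {s : Finset V} :
    s ∈ (cliqueComplex G).faces ↔ s.Nonempty ∧ G.IsClique s := Iff.rfl

theorem isFlag_cliqueComplex {V : Type*} (G : SimpleGraph V) : (cliqueComplex G).IsFlag := by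
  classical
  rintro s ⟨hne, hs, hsub⟩
  have h1 : ¬ G.IsClique (s : Set V) := fun h => hs ⟨hne, h⟩
  simp only [SimpleGraph.IsClique, Set.Pairwise, not_forall] at h1
  obtain ⟨u, hu, w, hw, huw, hadj⟩ := h1
  have h2 : ({u, w} : Finset V) ⊆ s := by
    intro x hx
    simp only [Finset.mem_insert, Finset.mem_singleton] at hx
    rcases hx with rfl | rfl
    exacts [hu, hw]
  rcases h2.eq_or_ssubset with h3 | h3
  · rw [← h3, Finset.card_pair huw]
  · have h4 := (hsub _ h3 ⟨u, by simp⟩).2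
    exact absurd (h4 (by simp) (by simp) huw) hadj

theorem mem_realization_cliqueComplex {V : Type*} [Fintype V] {G : SimpleGraph V} {x : V → ℝ} :
    x ∈ (cliqueComplex G).realization ↔ (∀ v, 0 ≤ x v) ∧ ∑ v, x v = 1 ∧
      ∀ u w, x u ≠ 0 → x w ≠ 0 → u ≠ w → G.Adj u w := by
  classical
  refine and_congr_right fun h0 => and_congr_right fun h1 => ⟨?_, fun h => ?_⟩
  · rintro ⟨s, ⟨-, hs⟩, hx⟩ u w hu hw huw
    exact hs ((hx u).2 hu) ((hx w).2 hw) huw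
  · refine ⟨Finset.univ.filter (fun v => x v ≠ 0), ⟨?_, ?_⟩, by simp⟩
    · by_contra hne
      rw [Finset.not_nonempty_iff_eq_empty, Finset.filter_eq_empty_iff] at hne
      rw [Finset.sum_eq_zero fun v hv => not_not.1 (hne hv)] at h1
      exact zero_ne_one h1
    · intro u hu w hw huw
      exact h u w (by simpa using hu) (by simpa using hw) huw

/-- The open star of a vertex `v` is the cone over the link of `v`. The graph of the link is given
as a graph `R` on a list `S`, identified with the neighbourhood of `v` by `e` and its inverse `π`. -/
theorem nonempty_openStar_homeomorph {V W : Type*} [Fintype V] {G : SimpleGraph V} {v : V}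
    {S : List W} {R : W → W → Bool} {e : W → V} {π : V → W} (hπ : ∀ s ∈ S, π (e s) = s)
    (he : ∀ w, G.Adj v w → π w ∈ S ∧ e (π w) = w) (hadj : ∀ s ∈ S, G.Adj v (e s))
    (hR : ∀ s ∈ S, ∀ t ∈ S, R s t = true ↔ G.Adj (e s) (e t)) :
    Nonempty ({x : (cliqueComplex G).realization // 0 < x.1 v} ≃ₜ cliqueCone S R) := by
  classical
  let f : (V → ℝ) → W → ℝ := fun x s => if s ∈ S then x (e s) / x v else 0
  let c : (W → ℝ) → V → ℝ := fun t w => if w = v then 1 else if G.Adj v w then t (π w) else 0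
  let g : (W → ℝ) → V → ℝ := fun t w => c t w / ∑ w, c t w
  have hcv : ∀ t, c t v = 1 := fun t => by simp [c]
  have hc0 : ∀ t ∈ cliqueCone S R, ∀ w, 0 ≤ c t w := by
    intro t ht w
    simp only [c]; split_ifs
    exacts [zero_le_one, ht.1 _, le_rfl]
  have hsum : ∀ t ∈ cliqueCone S R, 0 < ∑ w, c t w := by
    intro t ht
    refine lt_of_lt_of_le zero_lt_one ?_
    rw [← hcv t]
    exact Finset.single_le_sum (fun w _ => hc0 t ht w) (Finset.mem_univ v)
  have hce : ∀ t, ∀ s ∈ S, c t (e s) = t s := by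
    intro t s hs
    have h1 := hadj s hs
    simp only [c, h1.ne', if_false, h1, if_true, hπ s hs]
  have hf : ∀ x ∈ (cliqueComplex G).realization, 0 < x v → f x ∈ cliqueCone S R := by
    intro x hx hv
    obtain ⟨h0, h1, h2⟩ := mem_realization_cliqueComplex.1 hx
    have hne : ∀ s, f x s ≠ 0 → s ∈ S ∧ x (e s) ≠ 0 := by
      intro s hs
      simp only [f] at hs
      split_ifs at hs with h3
      · exact ⟨h3, fun h => hs (by simp [h])⟩
      · exact absurd rfl hs
    refine ⟨fun s => ?_, fun s hs => (hne s hs).1, fun s t hs ht hst => ?_⟩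
    · simp only [f]; split_ifs
      exacts [div_nonneg (h0 _) (h0 _), le_rfl]
    · obtain ⟨hs1, hs2⟩ := hne s hs
      obtain ⟨ht1, ht2⟩ := hne t ht
      refine (hR s hs1 t ht1).2 (h2 _ _ hs2 ht2 fun h => hst ?_)
      rw [← hπ s hs1, ← hπ t ht1, h]
  have hg : ∀ t ∈ cliqueCone S R, g t ∈ (cliqueComplex G).realization := by
    intro t ht
    refine mem_realization_cliqueComplex.2 ⟨fun w => div_nonneg (hc0 t ht w) (hsum t ht).le, ?_, ?_⟩
    · simp only [g]
      rw [← Finset.sum_div, div_self (hsum t ht).ne']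
    · have hne : ∀ w, g t w ≠ 0 → w ≠ v → G.Adj v w ∧ t (π w) ≠ 0 := by
        intro w hw hwv
        have h1 : c t w ≠ 0 := fun h => hw (by simp [g, h])
        simp only [c, hwv, if_false] at h1
        split_ifs at h1 with h2
        · exact ⟨h2, h1⟩
        · exact absurd rfl h1
      intro u w hu hw huw
      by_cases huv : u = v
      · subst huv; exact (hne w hw huw.symm).1
      by_cases hwv : w = v
      · subst hwv; exact (hne u hu huv).1.symm
      obtain ⟨hu1, hu2⟩ := hne u hu huv
      obtain ⟨hw1, hw2⟩ := hne w hw hwv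
      obtain ⟨hu3, hu4⟩ := he u hu1
      obtain ⟨hw3, hw4⟩ := he w hw1
      have h3 := (hR _ hu3 _ hw3).1 (ht.2.2 _ _ hu2 hw2 fun h => huw (by rw [← hu4, ← hw4, h]))
      rwa [hu4, hw4] at h3
  have hgv : ∀ t ∈ cliqueCone S R, 0 < g t v := fun t ht => by
    simp only [g, hcv]
    exact one_div_pos.2 (hsum t ht)
  have hgf : ∀ x ∈ (cliqueComplex G).realization, 0 < x v → g (f x) = x := by
    intro x hx hv
    obtain ⟨h0, h1, h2⟩ := mem_realization_cliqueComplex.1 hx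
    have h3 : ∀ w, c (f x) w = x w / x v := by
      intro w
      simp only [c]
      split_ifs with h4 h5
      · rw [h4, div_self hv.ne']
      · obtain ⟨h6, h7⟩ := he w h5
        simp only [f, h6, if_true, h7]
      · have : x w = 0 := by
          by_contra h
          exact h5 (h2 v w hv.ne' h (Ne.symm h4))
        simp [this]
    funext w
    simp only [g, h3]
    rw [← Finset.sum_div, h1]
    field_simp
  have hfg : ∀ t ∈ cliqueCone S R, f (g t) = t := by
    intro t ht
    funext s
    simp only [f, g]
    split_ifs with h1
    · rw [hce t s h1, hcv]
      have := (hsum t ht).ne'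
      field_simp
    · by_contra h
      exact h1 (ht.2.1 s (Ne.symm h))
  have hfc : Continuous fun x : {x : (cliqueComplex G).realization // 0 < x.1 v} => f x.1.1 := by
    refine continuous_pi fun s => ?_
    simp only [f]
    split_ifs
    · have hx : ∀ w, Continuous fun x : {x : (cliqueComplex G).realization // 0 < x.1 v} => x.1.1 w :=
        fun w => (continuous_apply w).comp (continuous_subtype_val.comp continuous_subtype_val)
      exact Continuous.div (hx _) (hx _) fun x => x.2.ne'
    · exact continuous_const
  have hcc : ∀ w, Continuous fun t => c t w := by
    intro w
    simp only [c]
    split_ifs <;> fun_prop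
  have hgc : Continuous fun t : cliqueCone S R => g t.1 := by
    refine continuous_pi fun w => ?_
    simp only [g]
    exact Continuous.div ((hcc w).comp continuous_subtype_val)
      (continuous_finsetSum _ fun w _ => (hcc w).comp continuous_subtype_val)
      fun t => (hsum t.1 t.2).ne'
  exact ⟨{ toFun := fun x => ⟨f x.1.1, hf _ x.1.2 x.2⟩
           invFun := fun t => ⟨⟨g t.1, hg _ t.2⟩, hgv _ t.2⟩
           left_inv := fun x => Subtype.ext (Subtype.ext (hgf _ x.1.2 x.2))
           right_inv := fun t => Subtype.ext (hfg _ t.2)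
           continuous_toFun := hfc.subtype_mk _
           continuous_invFun := (hgc.subtype_mk _).subtype_mk _ }⟩

/-- A complex whose open vertex stars are homeomorphic to `ℝ^d` is locally euclidean. -/
theorem nonempty_chartedSpace_of_openStars {V : Type*} [Fintype V]
    (K : AbstractSimplicialComplex V) (d : ℕ)
    (h : ∀ v, Nonempty ({x : K.realization // 0 < x.1 v} ≃ₜ (Fin d → ℝ))) :
    Nonempty (ChartedSpace (EuclideanSpace ℝ (Fin d)) K.realization) := by
  have hchart : ∀ x : K.realization,
      ∃ φ : OpenPartialHomeomorph K.realization (EuclideanSpace ℝ (Fin d)), x ∈ φ.source := by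
    intro x
    obtain ⟨v, hv⟩ : ∃ v, 0 < x.1 v := by
      by_contra! hv
      have := x.2.2.1
      rw [Finset.sum_eq_zero fun v _ => le_antisymm (hv v) (x.2.1 v)] at this
      exact zero_ne_one this
    obtain ⟨e⟩ := h v
    have hopen : IsOpen {x : K.realization | 0 < x.1 v} :=
      isOpen_lt continuous_const ((continuous_apply v).comp continuous_subtype_val)
    let e' := (EuclideanSpace.equiv (Fin d) ℝ).toHomeomorph.trans e.symm
    have hemb : Topology.IsOpenEmbedding fun y => (e' y).1 :=
      hopen.isOpenEmbedding_subtypeVal.comp e'.isOpenEmbedding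
    refine ⟨(hemb.toOpenPartialHomeomorph _).symm, ?_⟩
    simp only [OpenPartialHomeomorph.symm_source,
      Topology.IsOpenEmbedding.toOpenPartialHomeomorph_target]
    exact ⟨e'.symm ⟨x, hv⟩, by simp⟩
  choose φ hφ using hchart
  exact ⟨{ atlas := Set.range φ
           chartAt := φ
           mem_chart_source := hφ
           chart_mem_atlas := fun x => ⟨x, rfl⟩ }⟩

/-- The realization of the clique complex of a connected graph is connected: the open vertex stars
are star-shaped, and those of adjacent vertices meet. -/
theorem connectedSpace_realization_cliqueComplex {V : Type*} [Fintype V] {G : SimpleGraph V}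
    (hG : G.Connected) : ConnectedSpace (cliqueComplex G).realization := by
  classical
  have : Nonempty V := hG.nonempty
  rw [← isConnected_iff_connectedSpace]
  let U : V → Set (V → ℝ) := fun v => {x | x ∈ (cliqueComplex G).realization ∧ 0 < x v}
  have hU : (cliqueComplex G).realization = ⋃ v, U v := by
    ext x
    simp only [U, Set.mem_iUnion, Set.mem_ofPred_eq, exists_and_left, iff_self_and]
    intro hx
    by_contra! hv
    have := hx.2.1
    rw [Finset.sum_eq_zero fun v _ => le_antisymm (hv v) (hx.1 v)] at this
    exact zero_ne_one this
  have hvert : ∀ v, Pi.single v 1 ∈ U v := by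
    intro v
    refine ⟨mem_realization_cliqueComplex.2 ⟨fun w => ?_, by simp, fun u w hu hw huw => ?_⟩, by simp⟩
    · by_cases h : w = v
      · subst h; simp
      · simp [h]
    · have h1 : u = v := by by_contra h; simp [h] at hu
      have h2 : w = v := by by_contra h; simp [h] at hw
      exact absurd (h1.trans h2.symm) huw
  have hconn : ∀ v, IsConnected (U v) := by
    intro v
    have hstar : StarConvex ℝ (Pi.single v 1) (U v) := by
      rintro x ⟨hx, hxv⟩ a b ha hb hab
      obtain ⟨h0, h1, h2⟩ := mem_realization_cliqueComplex.1 hx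
      obtain ⟨h3, h4, h5⟩ := mem_realization_cliqueComplex.1 (hvert v).1
      refine ⟨mem_realization_cliqueComplex.2 ⟨fun w => ?_, ?_, fun u w hu hw huw => ?_⟩, ?_⟩
      · simp only [Pi.add_apply, Pi.smul_apply, smul_eq_mul]
        exact add_nonneg (mul_nonneg ha (h3 w)) (mul_nonneg hb (h0 w))
      · simp only [Pi.add_apply, Pi.smul_apply, smul_eq_mul, Finset.sum_add_distrib,
          ← Finset.mul_sum, h4, h1, mul_one, hab]
      · have h6 : ∀ w, (a • Pi.single v 1 + b • x : V → ℝ) w ≠ 0 → x w ≠ 0 := by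
          intro w hw h
          by_cases hwv : w = v
          · exact hxv.ne' (hwv ▸ h)
          · simp [h, hwv] at hw
        exact h2 u w (h6 u hu) (h6 w hw) huw
      · simp only [Pi.add_apply, Pi.smul_apply, smul_eq_mul, Pi.single_eq_same, mul_one]
        rcases hb.eq_or_lt with h | h
        · subst h; simp only [add_zero] at hab; simp [hab]
        · exact add_pos_of_nonneg_of_pos ha (mul_pos h hxv)
    exact (hstar.isPathConnected (hvert v)).isConnected
  rw [hU]
  refine IsConnected.iUnion_of_reflTransGen hconn fun u w => ?_
  have := (SimpleGraph.reachable_iff_reflTransGen u w).1 (hG.preconnected u w)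
  refine Relation.ReflTransGen.mono (fun u w huw => ?_) _ _ this
  -- The midpoint of the edge `uw` lies in both open stars.
  refine ⟨fun v => if v = u ∨ v = w then 1 / 2 else 0, ?_⟩
  have hmem : (fun v => if v = u ∨ v = w then (1 / 2 : ℝ) else 0) ∈
      (cliqueComplex G).realization := by
    refine mem_realization_cliqueComplex.2 ⟨fun v => ?_, ?_, fun x y hx hy hxy => ?_⟩
    · split_ifs <;> norm_num
    · rw [← Finset.sum_filter]
      have : Finset.univ.filter (fun v => v = u ∨ v = w) = {u, w} := by ext; simp
      rw [this, Finset.sum_pair huw.ne]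
      norm_num
    · have h1 : x = u ∨ x = w := by by_contra h; simp [h] at hx
      have h2 : y = u ∨ y = w := by by_contra h; simp [h] at hy
      rcases h1 with rfl | rfl <;> rcases h2 with rfl | rfl
      · exact absurd rfl hxy
      · exact huw
      · exact huw.symm
      · exact absurd rfl hxy
  exact ⟨⟨hmem, by simp⟩, ⟨hmem, by simp⟩⟩

theorem fNumber_zero_cliqueComplex {V : Type*} [Fintype V] (G : SimpleGraph V) :
    (cliqueComplex G).fNumber 0 = Fintype.card V := by
  rw [AbstractSimplicialComplex.fNumber, ← Nat.card_eq_fintype_card]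
  refine Nat.card_congr (Equiv.ofBijective
    (fun v => (⟨{v}, (cliqueComplex G).singleton_mem v, by simp⟩ :
      (cliqueComplex G).Simplex 0)) ⟨fun u v h => ?_, fun s => ?_⟩).symm
  · simpa using congrArg Subtype.val h
  · obtain ⟨v, hv⟩ := Finset.card_eq_one.1 s.2.2
    exact ⟨v, Subtype.ext hv.symm⟩

theorem two_mul_fNumber_one_cliqueComplex {V : Type*} [Fintype V] (G : SimpleGraph V)
    [DecidableRel G.Adj] : 2 * (cliqueComplex G).fNumber 1 = ∑ v, G.degree v := by
  classical
  rw [SimpleGraph.sum_degrees_eq_twice_card_edges, AbstractSimplicialComplex.fNumber,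
    SimpleGraph.edgeFinset_card, ← Nat.card_eq_fintype_card]
  congr 1
  refine Nat.card_congr (Equiv.ofBijective (fun z : G.edgeSet =>
    (⟨z.1.toFinset, ⟨?_, ?_⟩, ?_⟩ : (cliqueComplex G).Simplex 1)) ⟨fun y z h => ?_, fun s => ?_⟩).symm
  · obtain ⟨⟨u, w⟩, hz⟩ := z
    exact ⟨u, by simp⟩
  · obtain ⟨⟨u, w⟩, hz⟩ := z
    intro x hx y hy hxy
    have huw : G.Adj u w := hz
    simp only [Finset.mem_coe, Sym2.mem_toFinset, Sym2.mem_iff] at hx hy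
    rcases hx with rfl | rfl <;> rcases hy with rfl | rfl
    exacts [absurd rfl hxy, huw, huw.symm, absurd rfl hxy]
  · exact Sym2.card_toFinset_of_not_isDiag _ (G.not_isDiag_of_mem_edgeSet z.2)
  · refine Subtype.ext (Sym2.ext fun x => ?_)
    have : y.1.toFinset = z.1.toFinset := congrArg Subtype.val h
    rw [← Sym2.mem_toFinset, ← Sym2.mem_toFinset, this]
  · obtain ⟨u, w, huw, hs⟩ := Finset.card_eq_two.1 s.2.2
    have hadj : G.Adj u w := s.2.1.2 (by simp [hs]) (by simp [hs]) huw
    refine ⟨⟨s(u, w), hadj⟩, Subtype.ext ?_⟩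
    ext x
    simp [hs]

/-! ### Chains of a flag complex and its first homology -/

open Classical in
/-- The generator of the simplicial `i`-chains given by the set `s`, or zero if `s` is not an
`i`-dimensional face. -/
noncomputable def faceChain (R : Type*) [CommRing R] {V : Type*} (K : AbstractSimplicialComplex V)
    (i : ℕ) (s : Finset V) : K.Simplex i →₀ R :=
  if h : s ∈ K.faces ∧ s.card = i + 1 then Finsupp.single ⟨s, h⟩ 1 else 0

/-- The edge from `u` to `v` as an oriented simplicial `1`-chain of the clique complex; it is zero
when `u` and `v` are not adjacent. -/
noncomputable def edgeChain (R : Type*) [CommRing R] {V : Type*} [LinearOrder V]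
    (G : SimpleGraph V) (u v : V) : (cliqueComplex G).Simplex 1 →₀ R :=
  if u < v then faceChain R (cliqueComplex G) 1 {u, v}
  else -faceChain R (cliqueComplex G) 1 {u, v}

/-- An integral simplicial `1`-cocycle of the clique complex of `G`, as an antisymmetric function
on adjacent pairs. -/
structure IsCocycle {V : Type*} (G : SimpleGraph V) (ω : V → V → ℤ) : Prop where
  antisymm : ∀ u v, G.Adj u v → ω v u = -ω u v
  triangle : ∀ u v w, G.Adj u v → G.Adj v w → G.Adj u w → ω u v + ω v w = ω u w

theorem faceChain_val {R : Type*} [CommRing R] {V : Type*} {K : AbstractSimplicialComplex V} {i : ℕ} (σ : K.Simplex i) :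
    faceChain R K i σ.1 = Finsupp.single σ 1 := by
  rw [faceChain, dif_pos σ.2]

section

variable {R : Type*} [CommRing R] {V : Type*} [LinearOrder V] {G : SimpleGraph V}

theorem boundary_faceChain {K : AbstractSimplicialComplex V} {i : ℕ} (s : Finset V)
    (h : s ∈ K.faces ∧ s.card = i + 1 + 1) :
    K.boundary R i (faceChain R K (i + 1) s) =
      ∑ v ∈ s, (-1 : R) ^ (s.filter (fun w => w < v)).card • faceChain R K i (s.erase v) := by
  rw [faceChain, dif_pos h, AbstractSimplicialComplex.boundary,
    Finsupp.linearCombination_single, one_smul]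
  rw [← Finset.sum_coe_sort s]
  refine Finset.sum_congr rfl fun v _ => ?_
  have := faceChain_val (R := R) (AbstractSimplicialComplex.Simplex.delete ⟨s, h⟩ v)
  simp only [AbstractSimplicialComplex.Simplex.delete] at this
  rw [this, Finsupp.smul_single, smul_eq_mul, mul_one]
  rfl

theorem edgeChain_symm {u v : V} (h : u ≠ v) : edgeChain R G v u = -edgeChain R G u v := by
  unfold edgeChain
  rw [Finset.pair_comm v u]
  rcases lt_or_gt_of_ne h with h1 | h1
  · rw [if_pos h1, if_neg h1.asymm]
  · rw [if_pos h1, if_neg h1.asymm, neg_neg]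

theorem exists_lt_of_simplex_one (σ : (cliqueComplex G).Simplex 1) :
    ∃ u v, u < v ∧ G.Adj u v ∧ σ.1 = {u, v} := by
  obtain ⟨u, v, huv, hσ⟩ := Finset.card_eq_two.1 σ.2.2
  have hadj : G.Adj u v := σ.2.1.2 (by simp [hσ]) (by simp [hσ]) huv
  rcases lt_or_gt_of_ne huv with h | h
  · exact ⟨u, v, h, hadj, hσ⟩
  · exact ⟨v, u, h, hadj.symm, by rw [hσ, Finset.pair_comm]⟩

theorem exists_lt_lt_of_simplex_two (τ : (cliqueComplex G).Simplex 2) :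
    ∃ u v w, u < v ∧ v < w ∧ G.Adj u v ∧ G.Adj v w ∧ G.Adj u w ∧ τ.1 = {u, v, w} := by
  let f := τ.1.orderEmbOfFin τ.2.2
  have h01 : f 0 < f 1 := f.strictMono (by decide)
  have h12 : f 1 < f 2 := f.strictMono (by decide)
  have hm : ∀ i, f i ∈ (τ.1 : Set V) := fun i => Finset.orderEmbOfFin_mem _ _ i
  refine ⟨f 0, f 1, f 2, h01, h12, τ.2.1.2 (hm _) (hm _) h01.ne, τ.2.1.2 (hm _) (hm _) h12.ne,
    τ.2.1.2 (hm _) (hm _) (h01.trans h12).ne, ?_⟩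
  have h := Finset.range_orderEmbOfFin τ.1 τ.2.2
  ext x
  rw [← Finset.mem_coe, ← h]
  simp only [Set.mem_range, Finset.mem_insert, Finset.mem_singleton, f]
  constructor
  · rintro ⟨i, rfl⟩
    fin_cases i <;> simp
  · rintro (rfl | rfl | rfl) <;> exact ⟨_, rfl⟩

theorem edgeChain_induction {p : ((cliqueComplex G).Simplex 1 →₀ R) → Prop}
    (h0 : p 0) (hadd : ∀ x y, p x → p y → p (x + y)) (hsmul : ∀ (r : R) x, p x → p (r • x))
    (he : ∀ u v, G.Adj u v → p (edgeChain R G u v)) (x) : p x := by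
  induction x using Finsupp.induction_linear with
  | zero => exact h0
  | add x y hx hy => exact hadd x y hx hy
  | single σ r =>
    obtain ⟨u, v, huv, hadj, hσ⟩ := exists_lt_of_simplex_one σ
    have := hsmul r _ (he u v hadj)
    rwa [edgeChain, if_pos huv, ← hσ, faceChain_val, Finsupp.smul_single, smul_eq_mul,
      mul_one] at this

theorem boundary_edgeChain {u v : V} (h : G.Adj u v) :
    (cliqueComplex G).boundary R 0 (edgeChain R G u v) =
      faceChain R (cliqueComplex G) 0 {v} - faceChain R (cliqueComplex G) 0 {u} := by
  wlog huv : u < v generalizing u v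
  · have := this h.symm (lt_of_le_of_ne (not_lt.1 huv) h.ne')
    rw [edgeChain_symm h.ne', map_neg, this, neg_sub]
  have hface : ({u, v} : Finset V) ∈ (cliqueComplex G).faces := by
    refine ⟨⟨u, by simp⟩, ?_⟩
    intro x hx y hy hxy
    simp only [Finset.coe_insert, Finset.coe_singleton, Set.mem_insert_iff,
      Set.mem_singleton_iff] at hx hy
    rcases hx with rfl | rfl <;> rcases hy with rfl | rfl
    exacts [absurd rfl hxy, h, h.symm, absurd rfl hxy]
  rw [edgeChain, if_pos huv, boundary_faceChain _ ⟨hface, Finset.card_pair h.ne⟩,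
    Finset.sum_pair h.ne]
  have e1 : ({u, v} : Finset V).erase u = {v} := by
    ext x; simp only [Finset.mem_erase, Finset.mem_insert, Finset.mem_singleton]; grind
  have e2 : ({u, v} : Finset V).erase v = {u} := by
    ext x; simp only [Finset.mem_erase, Finset.mem_insert, Finset.mem_singleton]; grind
  have e3 : ({u, v} : Finset V).filter (fun w => w < u) = ∅ := by
    ext x; simp only [Finset.mem_filter, Finset.mem_insert, Finset.mem_singleton]; grind
  have e4 : ({u, v} : Finset V).filter (fun w => w < v) = {u} := by
    ext x; simp only [Finset.mem_filter, Finset.mem_insert, Finset.mem_singleton]; grind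
  rw [e1, e2, e3, e4]
  simp [sub_eq_add_neg]

theorem boundary_faceChain_triple {u v w : V} (huv : u < v) (hvw : v < w)
    (h : ({u, v, w} : Finset V) ∈ (cliqueComplex G).faces) :
    (cliqueComplex G).boundary R 1 (faceChain R (cliqueComplex G) 2 {u, v, w}) =
      edgeChain R G u v + edgeChain R G v w - edgeChain R G u w := by
  have huw := huv.trans hvw
  have hcard : ({u, v, w} : Finset V).card = 1 + 1 + 1 :=
    Finset.card_eq_three.2 ⟨u, v, w, huv.ne, huw.ne, hvw.ne, rfl⟩
  rw [boundary_faceChain _ ⟨h, hcard⟩, Finset.sum_insert (by simp [huv.ne, huw.ne]),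
    Finset.sum_pair hvw.ne]
  have e1 : ({u, v, w} : Finset V).erase u = {v, w} := by
    ext x; simp only [Finset.mem_erase, Finset.mem_insert, Finset.mem_singleton]; grind
  have e2 : ({u, v, w} : Finset V).erase v = {u, w} := by
    ext x; simp only [Finset.mem_erase, Finset.mem_insert, Finset.mem_singleton]; grind
  have e3 : ({u, v, w} : Finset V).erase w = {u, v} := by
    ext x; simp only [Finset.mem_erase, Finset.mem_insert, Finset.mem_singleton]; grind
  have e4 : ({u, v, w} : Finset V).filter (fun x => x < u) = ∅ := by
    ext x; simp only [Finset.mem_filter, Finset.mem_insert, Finset.mem_singleton]; grind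
  have e5 : ({u, v, w} : Finset V).filter (fun x => x < v) = {u} := by
    ext x; simp only [Finset.mem_filter, Finset.mem_insert, Finset.mem_singleton]; grind
  have e6 : ({u, v, w} : Finset V).filter (fun x => x < w) = {u, v} := by
    ext x; simp only [Finset.mem_filter, Finset.mem_insert, Finset.mem_singleton]; grind
  rw [e1, e2, e3, e4, e5, e6, Finset.card_pair huv.ne, edgeChain, edgeChain, edgeChain, if_pos huv,
    if_pos hvw, if_pos huw]
  simp only [Finset.card_empty, pow_zero, one_smul, Finset.card_singleton, pow_one, neg_smul,
    even_two, Even.neg_pow, one_pow]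
  abel

/-- The three edges of a triangle, in any orientation, add up to a boundary. -/
theorem triangle_mem_range_boundary {u v w : V} (huv : G.Adj u v) (hvw : G.Adj v w)
    (huw : G.Adj u w) : edgeChain R G u v + edgeChain R G v w - edgeChain R G u w ∈
      LinearMap.range ((cliqueComplex G).boundary R 1) := by
  have key : ∀ {u v w : V}, G.Adj u v → G.Adj v w → G.Adj u w → u < v → v < w →
      edgeChain R G u v + edgeChain R G v w - edgeChain R G u w ∈
        LinearMap.range ((cliqueComplex G).boundary R 1) := by
    intro u v w huv hvw huw h1 h2
    refine ⟨_, boundary_faceChain_triple h1 h2 ⟨⟨u, by simp⟩, ?_⟩⟩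
    exact (SimpleGraph.is3Clique_iff.2 ⟨u, v, w, huv, huw, hvw, rfl⟩).isClique
  have s1 := edgeChain_symm (R := R) (G := G) huv.ne
  have s2 := edgeChain_symm (R := R) (G := G) hvw.ne
  have s3 := edgeChain_symm (R := R) (G := G) huw.ne
  rcases lt_or_gt_of_ne huv.ne with h1 | h1 <;> rcases lt_or_gt_of_ne hvw.ne with h2 | h2 <;>
    rcases lt_or_gt_of_ne huw.ne with h3 | h3
  · exact key huv hvw huw h1 h2
  · exact absurd (h1.trans h2) h3.asymm
  · have := key huw hvw.symm huv h3 h2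
    rw [s2] at this
    rw [← neg_mem_iff]
    convert this using 1; abel
  · have := key huw.symm huv hvw.symm h3 h1
    rw [s3, s2] at this
    convert this using 1; abel
  · have := key huv.symm huw hvw h1 h3
    rw [s1] at this
    rw [← neg_mem_iff]
    convert this using 1; abel
  · have := key hvw huw.symm huv.symm h2 h3
    rw [s3, s1] at this
    convert this using 1; abel
  · exact absurd (h2.trans h1) h3.asymm
  · have := key hvw.symm huv.symm huw.symm h2 h1
    rw [s1, s2, s3] at this
    rw [← neg_mem_iff]
    convert this using 1; abel

/-- Evaluation of a `1`-cochain on `1`-chains. -/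
noncomputable def evalCochain (R : Type*) [CommRing R] (G : SimpleGraph V) (ω : V → V → ℤ) :
    ((cliqueComplex G).Simplex 1 →₀ R) →ₗ[R] R :=
  Finsupp.linearCombination R fun σ =>
    (ω (σ.1.min' σ.2.1.1) (σ.1.max' σ.2.1.1) : R)

theorem evalCochain_edgeChain {ω : V → V → ℤ} (hω : IsCocycle G ω) {u v : V} (h : G.Adj u v) :
    evalCochain R G ω (edgeChain R G u v) = ω u v := by
  wlog huv : u < v generalizing u v
  · have := this h.symm (lt_of_le_of_ne (not_lt.1 huv) h.ne')
    rw [edgeChain_symm h.ne', map_neg, this, hω.antisymm u v h, Int.cast_neg, neg_neg]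
  have hface : ({u, v} : Finset V) ∈ (cliqueComplex G).faces := by
    refine ⟨⟨u, by simp⟩, ?_⟩
    intro x hx y hy hxy
    simp only [Finset.coe_insert, Finset.coe_singleton, Set.mem_insert_iff,
      Set.mem_singleton_iff] at hx hy
    rcases hx with rfl | rfl <;> rcases hy with rfl | rfl
    exacts [absurd rfl hxy, h, h.symm, absurd rfl hxy]
  rw [edgeChain, if_pos huv, faceChain, dif_pos ⟨hface, Finset.card_pair h.ne⟩, evalCochain,
    Finsupp.linearCombination_single, one_smul]
  congr 2
  · exact le_antisymm (Finset.min'_le _ _ (by simp)) (Finset.le_min' _ _ _ fun x hx => by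
      simp only [Finset.mem_insert, Finset.mem_singleton] at hx
      rcases hx with rfl | rfl
      exacts [le_rfl, huv.le])
  · exact le_antisymm (Finset.max'_le _ _ _ fun x hx => by
      simp only [Finset.mem_insert, Finset.mem_singleton] at hx
      rcases hx with rfl | rfl
      exacts [huv.le, le_rfl]) (Finset.le_max' _ _ (by simp))

theorem evalCochain_boundary {ω : V → V → ℤ} (hω : IsCocycle G ω)
    (x : (cliqueComplex G).Simplex 2 →₀ R) :
    evalCochain R G ω ((cliqueComplex G).boundary R 1 x) = 0 := by
  induction x using Finsupp.induction_linear with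
  | zero => simp
  | add x y hx hy => rw [map_add, map_add, hx, hy, add_zero]
  | single τ r =>
    obtain ⟨u, v, w, huv, hvw, h1, h2, h3, hτ⟩ := exists_lt_lt_of_simplex_two τ
    have h4 : Finsupp.single τ r = r • faceChain R (cliqueComplex G) 2 {u, v, w} := by
      rw [← hτ, faceChain_val, Finsupp.smul_single, smul_eq_mul, mul_one]
    rw [h4, map_smul, map_smul, boundary_faceChain_triple huv hvw (hτ ▸ τ.2.1), map_sub, map_add,
      evalCochain_edgeChain hω h1, evalCochain_edgeChain hω h2, evalCochain_edgeChain hω h3,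
      ← hω.triangle u v w h1 h2 h3, Int.cast_add, sub_self, smul_zero]

/-- A homology module on which a system of functionals vanishing on boundaries is separating, and
has dual cycles `z j`, is free of rank the number of functionals. -/
theorem subquotientRank_eq_card {R : Type*} [CommRing R] [Nontrivial R] {M : Type*}
    [AddCommGroup M] [Module R M] {Z B : Submodule R M} {J : Type*} [Fintype J] [DecidableEq J]
    (Φ : M →ₗ[R] (J → R)) (z : J → M) (hz : ∀ j, z j ∈ Z)
    (hΦz : ∀ i j, Φ (z j) i = if i = j then 1 else 0) (hB : ∀ x ∈ Z, Φ x = 0 → x ∈ B)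
    (hΦB : ∀ x ∈ B, Φ x = 0) :
    AbstractSimplicialComplex.subquotientRank R Z B = Fintype.card J := by
  have hsurj : Function.Surjective (Φ ∘ₗ Z.subtype) := by
    intro a
    refine ⟨∑ j, a j • ⟨z j, hz j⟩, ?_⟩
    funext i
    rw [map_sum, Finset.sum_apply]
    simp [hΦz]
  have hker : LinearMap.ker (Φ ∘ₗ Z.subtype) = B.submoduleOf Z := by
    ext x
    rw [LinearMap.mem_ker, Submodule.submoduleOf, Submodule.mem_comap]
    exact ⟨fun h => hB x.1 x.2 h, fun h => hΦB _ h⟩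
  rw [AbstractSimplicialComplex.subquotientRank, ← hker,
    ((Φ ∘ₗ Z.subtype).quotKerEquivOfSurjective hsurj).finrank_eq,
    Module.finrank_fintype_fun_eq_card]

/-- The first Betti number from a system of cocycles `ω j` with dual cycles `z j`, provided that up
to boundaries every edge is a combination of the chains `ζ j` with coefficients `ω j`, corrected by
a difference of chains `c` attached to its end points. -/
theorem bettiNumber_one_eq_card [Nontrivial R] {J : Type*} [Fintype J] [DecidableEq J]
    {ω : J → V → V → ℤ} (hω : ∀ j, IsCocycle G (ω j))
    (c : V → (cliqueComplex G).Simplex 1 →₀ R) (ζ z : J → (cliqueComplex G).Simplex 1 →₀ R)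
    (hζ : ∀ u v, G.Adj u v → edgeChain R G u v - (c v - c u) - ∑ j, (ω j u v : R) • ζ j ∈
      LinearMap.range ((cliqueComplex G).boundary R 1))
    (hz : ∀ j, (cliqueComplex G).boundary R 0 (z j) = 0)
    (hωz : ∀ i j, evalCochain R G (ω i) (z j) = if i = j then 1 else 0) :
    (cliqueComplex G).bettiNumber R 1 = Fintype.card J := by
  let A : ((cliqueComplex G).Simplex 0 →₀ R) →ₗ[R] ((cliqueComplex G).Simplex 1 →₀ R) :=
    Finsupp.linearCombination R fun s => c (s.1.min' s.2.1.1)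
  have hA : ∀ v, A (faceChain R (cliqueComplex G) 0 {v}) = c v := by
    intro v
    rw [faceChain, dif_pos ⟨(cliqueComplex G).singleton_mem v, by simp⟩]
    simp only [A, Finsupp.linearCombination_single, one_smul, Finset.min'_singleton]
  -- Both sides of the relation in `hζ` are linear in the edge, so it holds for every chain.
  have hall : ∀ x, x - A ((cliqueComplex G).boundary R 0 x) - ∑ j, evalCochain R G (ω j) x • ζ j ∈ LinearMap.range ((cliqueComplex G).boundary R 1) := by
    intro x
    refine edgeChain_induction (G := G) (R := R)
      (p := fun x => x - A ((cliqueComplex G).boundary R 0 x) -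
        ∑ j, evalCochain R G (ω j) x • ζ j ∈ LinearMap.range ((cliqueComplex G).boundary R 1)) ?_ (fun x y hx hy => ?_) (fun r x hx => ?_)
      (fun u v huv => ?_) x
    · simp
    · convert (LinearMap.range ((cliqueComplex G).boundary R 1)).add_mem hx hy using 1
      simp only [map_add, add_smul, Finset.sum_add_distrib]
      abel
    · convert (LinearMap.range ((cliqueComplex G).boundary R 1)).smul_mem r hx using 1
      simp only [map_smul, smul_sub, Finset.smul_sum, smul_eq_mul, mul_smul]
    · rw [boundary_edgeChain huv, map_sub, hA, hA]
      simp only [evalCochain_edgeChain (hω _) huv]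
      exact hζ u v huv
  refine subquotientRank_eq_card (LinearMap.pi fun j => evalCochain R G (ω j)) z hz
    (fun i j => hωz i j) (fun x hx h => ?_) ?_
  · have h1 := hall x
    have h2 : (cliqueComplex G).boundary R 0 x = 0 := hx
    have h3 : ∀ j, evalCochain R G (ω j) x = 0 := fun j => congrFun h j
    simpa [h2, h3] using h1
  · rintro _ ⟨y, rfl⟩
    funext j
    exact evalCochain_boundary (hω j) y

end

section

variable {R : Type*} [CommRing R] {V : Type*} [LinearOrder V] {G : SimpleGraph V}

/-- The chain of the first `n` edges of the walk `p`. -/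
noncomputable def walkChain (R : Type*) [CommRing R] (G : SimpleGraph V) (p : ℕ → V) (n : ℕ) :
    (cliqueComplex G).Simplex 1 →₀ R :=
  ∑ i ∈ Finset.range n, edgeChain R G (p i) (p (i + 1))

theorem boundary_walkChain {p : ℕ → V} (hp : ∀ n, G.Adj (p n) (p (n + 1))) (n : ℕ) :
    (cliqueComplex G).boundary R 0 (walkChain R G p n) =
      faceChain R (cliqueComplex G) 0 {p n} - faceChain R (cliqueComplex G) 0 {p 0} := by
  induction n with
  | zero => simp [walkChain]
  | succ n ih =>
    rw [walkChain, Finset.sum_range_succ, map_add, ← walkChain, ih, boundary_edgeChain (hp n)]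
    abel

theorem evalCochain_walkChain {ω : V → V → ℤ} (hω : IsCocycle G ω) {p : ℕ → V}
    (hp : ∀ n, G.Adj (p n) (p (n + 1))) (n : ℕ) :
    evalCochain R G ω (walkChain R G p n) =
      ((∑ i ∈ Finset.range n, ω (p i) (p (i + 1)) : ℤ) : R) := by
  rw [walkChain, map_sum, Int.cast_sum]
  exact Finset.sum_congr rfl fun i _ => evalCochain_edgeChain hω (hp i)

/-- Let `p` be a hamiltonian cycle, and suppose that every edge follows by triangles from the edges
of `p` and the chords `a j, b j`. If there are a cocycle `ω₀` concentrated on the closing edge of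
`p` and vanishing on the chords, and cocycles `ω j` vanishing on `p` and dual to the chords, then the
first homology is free on the class of `p` and those of the chords closed up along `p`. -/
theorem bettiNumber_one_of_hamiltonianCycle [Nontrivial R] {ι : Type*} [Fintype ι] [DecidableEq ι]
    {N : ℕ} {p : ℕ → V} {idx : V → ℕ} (hidx : ∀ v, p (idx v) = v) (hlt : ∀ v, idx v < N)
    (hidx' : ∀ n < N, idx (p n) = n) (hp : p N = p 0) (hadj : ∀ n, G.Adj (p n) (p (n + 1)))
    {ω₀ : V → V → ℤ} {ω : ι → V → V → ℤ} (hω₀ : IsCocycle G ω₀) (hω : ∀ i, IsCocycle G (ω i))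
    {a b : ι → V} (hab : ∀ i, G.Adj (a i) (b i))
    (h00 : ∀ n, n + 1 < N → ω₀ (p n) (p (n + 1)) = 0)
    (h01 : ∀ n, n + 1 = N → ω₀ (p n) (p (n + 1)) = 1)
    (h10 : ∀ i, ∀ n < N, ω i (p n) (p (n + 1)) = 0)
    (h02 : ∀ i, ω₀ (a i) (b i) = 0)
    (h12 : ∀ i j, ω i (a j) (b j) = if i = j then 1 else 0)
    (hgen : ∀ S : V → V → Prop, (∀ u v, G.Adj u v → S u v → S v u) →
      (∀ u v w, G.Adj u v → G.Adj v w → G.Adj u w → S u v → S v w → S u w) →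
      (∀ n < N, S (p n) (p (n + 1))) → (∀ i, S (a i) (b i)) → ∀ u v, G.Adj u v → S u v) :
    (cliqueComplex G).bettiNumber R 1 = Fintype.card ι + 1 := by
  have hN : 0 < N := lt_of_le_of_lt (Nat.zero_le _) (hlt (p 0))
  let c : V → (cliqueComplex G).Simplex 1 →₀ R := fun v => walkChain R G p (idx v)
  let Ω : Option ι → V → V → ℤ := fun o => o.elim ω₀ ω
  let ζ : Option ι → (cliqueComplex G).Simplex 1 →₀ R := fun o =>
    o.elim (walkChain R G p N) fun i => edgeChain R G (a i) (b i) - (c (b i) - c (a i))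
  have hΩ : ∀ o, IsCocycle G (Ω o) := fun o => by
    cases o
    exacts [hω₀, hω _]
  have hsum0 : ∀ n < N, ∑ i ∈ Finset.range n, ω₀ (p i) (p (i + 1)) = 0 := fun n hn =>
    Finset.sum_eq_zero fun i hi => h00 i (by have := Finset.mem_range.1 hi; omega)
  have hsum1 : ∀ j, ∀ n ≤ N, ∑ i ∈ Finset.range n, ω j (p i) (p (i + 1)) = 0 := fun j n hn =>
    Finset.sum_eq_zero fun i hi => h10 j i (by have := Finset.mem_range.1 hi; omega)
  have hsumN : ∑ i ∈ Finset.range N, ω₀ (p i) (p (i + 1)) = 1 := by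
    obtain ⟨n, rfl⟩ := Nat.exists_eq_succ_of_ne_zero hN.ne'
    rw [Finset.sum_range_succ, hsum0 n (Nat.lt_succ_self n), h01 n rfl, zero_add]
  have hc : ∀ v, (cliqueComplex G).boundary R 0 (c v) =
      faceChain R (cliqueComplex G) 0 {v} - faceChain R (cliqueComplex G) 0 {p 0} := fun v => by
    rw [boundary_walkChain hadj, hidx]
  have hc0 : ∀ v, evalCochain R G ω₀ (c v) = 0 := fun v => by
    rw [evalCochain_walkChain hω₀ hadj, hsum0 _ (hlt v), Int.cast_zero]
  have hc1 : ∀ j v, evalCochain R G (ω j) (c v) = 0 := fun j v => by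
    rw [evalCochain_walkChain (hω j) hadj, hsum1 j _ (hlt v).le, Int.cast_zero]
  rw [← Fintype.card_option]
  refine bettiNumber_one_eq_card hΩ c ζ ζ (hgen _ ?_ ?_ ?_ ?_) ?_ ?_
  · intro u v huv h
    rw [← neg_mem_iff]
    convert h using 1
    have h1 : ∀ j, Ω j v u = -Ω j u v := fun j => (hΩ j).antisymm u v huv
    simp only [edgeChain_symm huv.ne, h1, Int.cast_neg, neg_smul, Finset.sum_neg_distrib]
    abel
  · intro u v w huv hvw huw h1 h2
    have h3 := triangle_mem_range_boundary (R := R) huv hvw huw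
    convert sub_mem (add_mem h1 h2) h3 using 1
    have h4 : ∀ j, Ω j u w = Ω j u v + Ω j v w := fun j =>
      ((hΩ j).triangle u v w huv hvw huw).symm
    simp only [h4, Int.cast_add, add_smul, Finset.sum_add_distrib]
    abel
  · intro n hn
    convert Submodule.zero_mem _ using 1
    rw [Fintype.sum_option]
    simp only [Ω, Option.elim, h10 _ n hn, Int.cast_zero, zero_smul, Finset.sum_const_zero,
      add_zero, c, hidx' n hn, ζ]
    rcases Nat.lt_or_ge (n + 1) N with h | h
    · rw [hidx' _ h, h00 n h, walkChain, walkChain, Finset.sum_range_succ]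
      simp
    · have h' : n + 1 = N := by omega
      subst h'
      rw [h01 n rfl, hp, hidx' 0 hN]
      simp only [walkChain, Finset.sum_range_succ, hp, Int.cast_one, one_smul, Finset.sum_range_zero]
      abel
  · intro i
    convert Submodule.zero_mem _ using 1
    rw [Fintype.sum_option]
    simp [Ω, ζ, h02, h12]
  · intro o
    cases o with
    | none => simp only [ζ, Option.elim, boundary_walkChain hadj, hp, sub_self]
    | some i =>
      simp only [ζ, Option.elim, map_sub, boundary_edgeChain (hab i), hc]
      abel
  · intro o o'
    cases o' with
    | none =>
      cases o with
      | none => simp [Ω, ζ, evalCochain_walkChain hω₀ hadj, hsumN]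
      | some i => simp [Ω, ζ, evalCochain_walkChain (hω i) hadj, hsum1 i N le_rfl]
    | some j =>
      cases o with
      | none => simp [Ω, ζ, evalCochain_edgeChain hω₀ (hab j), hc0, h02]
      | some i => simp [Ω, ζ, evalCochain_edgeChain (hω i) (hab j), hc1, h12]

end

/-! ### Cyclic coverings of graphs with voltages -/

/-- A graph on `Fin m`, with hamiltonian cycle `s ↦ s + 1`, together with cocycles on its clique
complex: the voltage, which counts how often an edge runs through the closing edge of the
hamiltonian cycle, and `r` further ones, dual to `r` chords and supported away from the voltage. The
rank orders the edges so that each edge, apart from those of the hamiltonian cycle and the chords, is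
the third side of a triangle whose other sides come earlier. -/
structure VoltageGraph (m r : ℕ) [NeZero m] where
  /-- adjacency -/
  adj : Fin m → Fin m → Bool
  /-- the voltage, a cocycle -/
  volt : Fin m → Fin m → ℤ
  /-- the cocycle dual to a chord -/
  cross : Fin r → Fin m → Fin m → ℤ
  /-- the first end point of a chord -/
  tail : Fin r → Fin m
  /-- the second end point of a chord -/
  head : Fin r → Fin m
  /-- the order in which edges are generated -/
  rank : Fin m → Fin m → ℕ
  adj_symm : ∀ s t, adj s t = adj t s
  adj_self : ∀ s, adj s s = false
  volt_antisymm : ∀ s t, adj s t → volt t s = -volt s t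
  volt_triangle : ∀ s t, adj s t → ∀ u, adj t u → adj s u → volt s t + volt t u = volt s u
  cross_antisymm : ∀ j s t, adj s t → cross j t s = -cross j s t
  cross_triangle : ∀ j s t, adj s t → ∀ u, adj t u → adj s u →
    cross j s t + cross j t u = cross j s u
  volt_eq_zero : ∀ j s t, adj s t → cross j s t ≠ 0 → volt s t = 0
  volt_eq_zero_of_triangle : ∀ j s t, adj s t → cross j s t ≠ 0 → ∀ u, adj t u → adj s u →
    volt t u = 0
  adj_succ : ∀ s, adj s (s + 1)
  volt_succ : ∀ s, volt s (s + 1) = if s + 1 = 0 then 1 else 0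
  cross_succ : ∀ j s, cross j s (s + 1) = 0
  adj_chord : ∀ j, adj (tail j) (head j)
  cross_chord : ∀ i j, cross i (tail j) (head j) = if i = j then 1 else 0
  generate : ∀ s t, adj s t → t = s + 1 ∨ s = t + 1 ∨
    (∃ j, s = tail j ∧ t = head j ∨ s = head j ∧ t = tail j) ∨
    ∃ u, adj s u ∧ adj u t ∧ rank s u < rank s t ∧ rank u t < rank s t

namespace VoltageGraph

variable {m r : ℕ} [NeZero m] (F : VoltageGraph m r) (d : ℕ)

/-- The `d`-fold cyclic covering determined by the voltage. -/
def cover : SimpleGraph (ZMod d × Fin m) where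
  Adj x y := F.adj x.2 y.2 ∧ y.1 = x.1 + (F.volt x.2 y.2 : ZMod d)
  symm := ⟨fun x y h => ⟨by rw [F.adj_symm]; exact h.1, by
    rw [h.2, F.volt_antisymm _ _ h.1, Int.cast_neg, add_neg_cancel_right]⟩⟩
  loopless := ⟨fun x h => by simp [F.adj_self] at h⟩

theorem generate_induction {S : Fin m → Fin m → Prop} (hsymm : ∀ s t, F.adj s t → S s t → S t s)
    (htri : ∀ s t u, F.adj s t → F.adj t u → F.adj s u → S s t → S t u → S s u)
    (hsucc : ∀ s, S s (s + 1)) (hchord : ∀ j, S (F.tail j) (F.head j)) :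
    ∀ s t, F.adj s t → S s t := by
  have key : ∀ n s t, F.rank s t = n → F.adj s t → S s t := by
    intro n
    induction n using Nat.strong_induction_on with
    | _ n ih =>
      intro s t hn hst
      rcases F.generate s t hst with rfl | rfl | ⟨j, ⟨rfl, rfl⟩ | ⟨rfl, rfl⟩⟩ | ⟨u, h1, h2, h3, h4⟩
      · exact hsucc s
      · exact hsymm _ _ (F.adj_succ t) (hsucc t)
      · exact hchord j
      · exact hsymm _ _ (F.adj_chord j) (hchord j)
      · exact htri s u t h1 h2 hst (ih _ (hn ▸ h3) s u rfl h1) (ih _ (hn ▸ h4) u t rfl h2)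
  exact fun s t => key _ s t rfl

theorem volt_chord (j : Fin r) : F.volt (F.tail j) (F.head j) = 0 :=
  F.volt_eq_zero j _ _ (F.adj_chord j) (by simp [F.cross_chord])

/-- The hamiltonian cycle of the covering that lifts that of the base. -/
def coverPath (n : ℕ) : ZMod d × Fin m := (((n / m : ℕ) : ZMod d), Fin.ofNat m n)

theorem ofNat_succ (n : ℕ) : Fin.ofNat m (n + 1) = Fin.ofNat m n + 1 := by
  ext; simp [Fin.val_add]

theorem ofNat_succ_eq_zero (n : ℕ) : Fin.ofNat m n + 1 = 0 ↔ m ∣ n + 1 := by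
  rw [← ofNat_succ, Fin.ext_iff, Nat.dvd_iff_mod_eq_zero]
  simp

theorem adj_coverPath (n : ℕ) : (F.cover d).Adj (coverPath d n) (coverPath (m := m) d (n + 1)) := by
  refine ⟨?_, ?_⟩
  · simp only [coverPath, ofNat_succ]
    exact F.adj_succ _
  · simp only [coverPath, ofNat_succ, F.volt_succ, ofNat_succ_eq_zero, Nat.succ_div]
    split_ifs <;> simp

/-- The cocycle that counts how often an edge of the covering runs through the closing edge of the
hamiltonian cycle. The division is exact. -/
def windingCocycle (x y : ZMod d × Fin m) : ℤ :=
  (F.volt x.2 y.2 + x.1.val - y.1.val) / d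

/-- The lift of the cocycle dual to a chord that is supported over the sheet `i.1`. -/
def crossCocycle (i : ZMod d × Fin r) (x y : ZMod d × Fin m) : ℤ :=
  if x.1 = i.1 then F.cross i.2 x.2 y.2 else 0

theorem isCocycle_crossCocycle (i : ZMod d × Fin r) :
    IsCocycle (F.cover d) (F.crossCocycle d i) := by
  refine ⟨fun x y h => ?_, fun x y z hxy hyz hxz => ?_⟩
  · simp only [crossCocycle]
    have h1 := F.cross_antisymm i.2 _ _ h.1
    by_cases h2 : F.cross i.2 x.2 y.2 = 0
    · simp [h1, h2]
    · have h3 := h.2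
      rw [F.volt_eq_zero i.2 _ _ h.1 h2, Int.cast_zero, add_zero] at h3
      rw [h3, h1]
      split_ifs <;> simp
  · simp only [crossCocycle]
    have h1 := F.cross_triangle i.2 _ _ hxy.1 _ hyz.1 hxz.1
    rw [← h1]
    by_cases h2 : F.cross i.2 y.2 z.2 = 0
    · simp [h2]
    · -- The cocycle does not vanish on `yz`, so the voltage vanishes on the whole triangle.
      have hzx : F.adj z.2 x.2 := by rw [F.adj_symm]; exact hxz.1
      have hyx : F.adj y.2 x.2 := by rw [F.adj_symm]; exact hxy.1
      have h3 := F.volt_eq_zero_of_triangle i.2 _ _ hyz.1 h2 x.2 hzx hyx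
      have h4 := F.volt_eq_zero i.2 _ _ hyz.1 h2
      have h5 := F.volt_triangle _ _ hyz.1 _ hzx hyx
      have h6 := hxy.symm.2
      rw [← h5, h3, h4, add_zero, Int.cast_zero, add_zero] at h6
      rw [h6]
      split_ifs <;> simp

theorem val_coverPath {n : ℕ} (h : n < d * m) : (coverPath (m := m) d n).1.val = n / m := by
  simp only [coverPath]
  exact ZMod.val_cast_of_lt (Nat.div_lt_of_lt_mul (by rwa [mul_comm]))

variable [NeZero d]

theorem mul_windingCocycle {x y : ZMod d × Fin m} (h : (F.cover d).Adj x y) :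
    (d : ℤ) * F.windingCocycle d x y = F.volt x.2 y.2 + x.1.val - y.1.val := by
  refine Int.mul_ediv_cancel' ?_
  rw [← ZMod.intCast_zmod_eq_zero_iff_dvd]
  push_cast
  simp [h.2, add_comm]

theorem isCocycle_windingCocycle : IsCocycle (F.cover d) (F.windingCocycle d) := by
  have hd : (d : ℤ) ≠ 0 := by exact_mod_cast NeZero.ne d
  refine ⟨fun x y h => mul_left_cancel₀ hd ?_, fun x y z hxy hyz hxz => mul_left_cancel₀ hd ?_⟩
  · rw [mul_neg, F.mul_windingCocycle d h, F.mul_windingCocycle d h.symm,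
      F.volt_antisymm _ _ h.1]
    ring
  · rw [mul_add, F.mul_windingCocycle d hxy, F.mul_windingCocycle d hyz,
      F.mul_windingCocycle d hxz, ← F.volt_triangle _ _ hxy.1 _ hyz.1 hxz.1]
    ring

theorem coverPath_index (x : ZMod d × Fin m) : coverPath d (x.1.val * m + x.2) = x := by
  have hm : 0 < m := Nat.pos_of_ne_zero (NeZero.ne m)
  refine Prod.ext ?_ (Fin.ext ?_)
  · simp only [coverPath]
    rw [mul_comm, Nat.mul_add_div hm, Nat.div_eq_of_lt x.2.2, add_zero, ZMod.natCast_zmod_val]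
  · simp [coverPath, Nat.mod_eq_of_lt x.2.2]

theorem bettiNumber_cover (R : Type*) [CommRing R] [Nontrivial R] [LinearOrder (ZMod d × Fin m)] :
    (cliqueComplex (F.cover d)).bettiNumber R 1 = d * r + 1 := by
  have hm : 0 < m := Nat.pos_of_ne_zero (NeZero.ne m)
  have hd0 : 0 < d := Nat.pos_of_ne_zero (NeZero.ne d)
  have hd : (d : ℤ) ≠ 0 := by exact_mod_cast NeZero.ne d
  have hcard : Fintype.card (ZMod d × Fin r) = d * r := by
    rw [Fintype.card_prod, ZMod.card, Fintype.card_fin]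
  have hend : coverPath (m := m) d (d * m) = coverPath d 0 := by
    simp [coverPath, Nat.mul_div_cancel _ hm, Fin.ext_iff]
  have hidx' : ∀ n < d * m, (coverPath (m := m) d n).1.val * m + (coverPath (m := m) d n).2 = n := by
    intro n hn
    rw [val_coverPath d hn]
    simp only [coverPath, Fin.val_ofNat]
    rw [mul_comm, Nat.div_add_mod]
  have hvolt : ∀ n, F.volt (coverPath (m := m) d n).2 (coverPath (m := m) d (n + 1)).2 =
      if m ∣ n + 1 then 1 else 0 := by
    intro n
    simp only [coverPath, ofNat_succ, F.volt_succ, ofNat_succ_eq_zero]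
  rw [← hcard]
  refine bettiNumber_one_of_hamiltonianCycle (N := d * m) (p := coverPath d)
    (idx := fun x => x.1.val * m + x.2) (coverPath_index d) (fun x => ?_) hidx' hend
    (F.adj_coverPath d) (F.isCocycle_windingCocycle d) (F.isCocycle_crossCocycle d)
    (a := fun i => (i.1, F.tail i.2)) (b := fun i => (i.1, F.head i.2)) (fun i => ?_)
    (fun n hn => ?_) (fun n hn => ?_) (fun i n _ => ?_) (fun i => ?_) (fun i j => ?_) ?_
  · have h1 : x.1.val + 1 ≤ d := ZMod.val_lt x.1
    have h2 := x.2.2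
    nlinarith
  · exact ⟨F.adj_chord _, by simp [F.volt_chord]⟩
  · refine mul_left_cancel₀ hd ?_
    rw [F.mul_windingCocycle d (F.adj_coverPath d n), hvolt, val_coverPath d (by omega),
      val_coverPath d hn, Nat.succ_div]
    split_ifs <;> simp only [Nat.cast_add, Nat.cast_one, add_zero] <;> ring
  · refine mul_left_cancel₀ hd ?_
    have h1 : m ∣ n + 1 := hn ▸ dvd_mul_left m d
    have h2 : (n + 1) / m = d := by rw [hn, Nat.mul_div_cancel _ hm]
    rw [Nat.succ_div, if_pos h1] at h2
    rw [F.mul_windingCocycle d (F.adj_coverPath d n), hvolt, val_coverPath d (by omega), hn, hend,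
      val_coverPath d (Nat.mul_pos hd0 hm), if_pos (dvd_mul_left m d), ← h2]
    simp [add_comm]
  · simp only [crossCocycle, coverPath, ofNat_succ, F.cross_succ, ite_self]
  · refine mul_left_cancel₀ hd ?_
    have h1 : (F.cover d).Adj (i.1, F.tail i.2) (i.1, F.head i.2) :=
      ⟨F.adj_chord _, by simp [F.volt_chord]⟩
    rw [F.mul_windingCocycle d h1]
    simp [F.volt_chord]
  · simp only [crossCocycle, F.cross_chord, Prod.ext_iff, eq_comm (a := i.1)]
    split_ifs <;> simp_all
  · intro S hsymm htri hpath hchord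
    -- All lifts of the edges of the base satisfy `S`, as this holds for the generating edges.
    have key : ∀ s t, F.adj s t → ∀ k : ZMod d, S (k, s) (k + F.volt s t, t) := by
      refine F.generate_induction (S := fun s t => ∀ k : ZMod d, S (k, s) (k + F.volt s t, t))
        (fun s t hst h k => ?_) (fun s t u hst htu hsu h1 h2 k => ?_) (fun s k => ?_) fun j k => ?_
      · have h1 := h (k - F.volt s t)
        rw [sub_add_cancel] at h1
        have h2 : (F.cover d).Adj (k - (F.volt s t : ZMod d), s) (k, t) := ⟨hst, by simp⟩
        have h3 := hsymm _ _ h2 h1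
        rwa [F.volt_antisymm s t hst, Int.cast_neg, ← sub_eq_add_neg]
      · have h3 := F.volt_triangle s t hst u htu hsu
        have h4 := h2 (k + F.volt s t)
        rw [add_assoc, ← Int.cast_add, h3] at h4
        refine htri _ _ _ ⟨hst, rfl⟩ ⟨htu, ?_⟩ ⟨hsu, rfl⟩ (h1 k) h4
        simp only
        rw [add_assoc, ← Int.cast_add, h3]
      · have h1 : (k.val * m + s) < d * m := by
          have h1 : k.val + 1 ≤ d := ZMod.val_lt k
          have h2 := s.2
          nlinarith
        have h2 := hpath _ h1
        have h3 := (F.adj_coverPath d (k.val * m + s)).2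
        have h4 := coverPath_index d (k, s)
        simp only at h4
        have h5 : (coverPath (m := m) d (k.val * m + s + 1)).2 = s + 1 := by
          have := congrArg Prod.snd h4
          simp only [coverPath] at this ⊢
          rw [ofNat_succ, this]
        rw [h4, h5] at h3
        rw [h4] at h2
        have h6 : coverPath d (k.val * m + s + 1) = (k + (F.volt s (s + 1) : ZMod d), s + 1) :=
          Prod.ext h3 h5
        rwa [h6] at h2
      · rw [F.volt_chord, Int.cast_zero, add_zero]
        exact hchord (k, j)
    intro x y hxy
    have := key _ _ hxy.1 x.1
    rwa [← hxy.2] at this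

end VoltageGraph

namespace VoltageGraph

variable {m r : ℕ} [NeZero m] (F : VoltageGraph m r) (d : ℕ) [NeZero d]

/-- The covering is a 3-manifold if the links in the base reduce to the octahedron: the covering
restricts to an isomorphism on the open star of each vertex. -/
theorem isSimplicialManifold_cover {n : ℕ}
    (hlink : ∀ s, reducesToOctahedron n ((List.finRange m).filter (F.adj s)) F.adj = true)
    (h4 : ∃ a b c e, F.adj a b ∧ F.adj a c ∧ F.adj a e ∧ F.adj b c ∧ F.adj b e ∧ F.adj c e)
    (h5 : ∀ a b, a < b → F.adj a b → ∀ c, b < c → F.adj a c → F.adj b c →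
      ∀ e, c < e → F.adj a e → F.adj b e → F.adj c e →
      ∀ f, e < f → F.adj a f → F.adj b f → F.adj c f → F.adj e f → False) :
    (cliqueComplex (F.cover d)).IsSimplicialManifold 3 := by
  refine ⟨⟨?_, ?_⟩, nonempty_chartedSpace_of_openStars _ _ fun v => ?_⟩
  · obtain ⟨a, b, c, e, hab, hac, hae, hbc, hbe, hce⟩ := h4
    let g : Fin m → ZMod d × Fin m := fun s => ((F.volt a s : ZMod d), s)
    have hg : ∀ s t, F.adj a s → F.adj a t → F.adj s t → (F.cover d).Adj (g s) (g t) := by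
      intro s t hs ht hst
      refine ⟨hst, ?_⟩
      simp only [g]
      rw [← Int.cast_add, F.volt_triangle a s hs t hst ht]
    have hg0 : ∀ s, F.adj a s → (F.cover d).Adj (0, a) (g s) := fun s hs =>
      ⟨hs, by simp [g]⟩
    have hclique : (F.cover d).IsNClique 4 {(0, a), g b, g c, g e} :=
      (SimpleGraph.is3Clique_iff.2 ⟨g b, g c, g e, hg b c hab hac hbc, hg b e hab hae hbe,
        hg c e hac hae hce, rfl⟩).insert (by simp [hg0 b hab, hg0 c hac, hg0 e hae])
    exact ⟨_, ⟨⟨(0, a), by simp⟩, hclique.isClique⟩, hclique.card_eq⟩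
  · rintro s ⟨-, hs⟩
    by_contra! hcard
    have hadj : ∀ x ∈ s, ∀ y ∈ s, x ≠ y → F.adj x.2 y.2 := fun x hx y hy hxy => (hs hx hy hxy).1
    have hinj : Set.InjOn Prod.snd (s : Set (ZMod d × Fin m)) := by
      intro x hx y hy hxy
      by_contra hne
      have := hadj x hx y hy hne
      rw [hxy, F.adj_self] at this
      exact absurd this (by simp)
    have himg : 5 ≤ (s.image Prod.snd).card := by
      rw [Finset.card_image_of_injOn hinj]
      exact hcard
    obtain ⟨T, hT, hTcard⟩ := Finset.exists_subset_card_eq himg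
    let f := T.orderEmbOfFin hTcard
    have hf : ∀ i j, i < j → F.adj (f i) (f j) := by
      intro i j hij
      obtain ⟨x, hx, hxi⟩ := Finset.mem_image.1 (hT (Finset.orderEmbOfFin_mem T hTcard i))
      obtain ⟨y, hy, hyj⟩ := Finset.mem_image.1 (hT (Finset.orderEmbOfFin_mem T hTcard j))
      have h1 : f i < f j := f.strictMono hij
      have h2 : x.2 = f i := hxi
      have h3 : y.2 = f j := hyj
      rw [← h2, ← h3] at h1 ⊢
      exact hadj x hx y hy fun h => by simp [h] at h1
    have hlt : ∀ i j, i < j → f i < f j := fun i j hij => f.strictMono hij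
    exact h5 (f 0) (f 1) (hlt _ _ (by decide)) (hf _ _ (by decide))
      (f 2) (hlt _ _ (by decide)) (hf _ _ (by decide)) (hf _ _ (by decide))
      (f 3) (hlt _ _ (by decide)) (hf _ _ (by decide)) (hf _ _ (by decide)) (hf _ _ (by decide))
      (f 4) (hlt _ _ (by decide)) (hf _ _ (by decide)) (hf _ _ (by decide)) (hf _ _ (by decide))
      (hf _ _ (by decide))
  · obtain ⟨k, s⟩ := v
    obtain ⟨φ⟩ := nonempty_homeomorph_of_reducesToOctahedron n _ F.adj F.adj_symm F.adj_self
      (hlink s)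
    obtain ⟨ψ⟩ := nonempty_openStar_homeomorph (G := F.cover d) (v := (k, s))
      (S := (List.finRange m).filter (F.adj s)) (R := F.adj)
      (e := fun t => (k + (F.volt s t : ZMod d), t)) (π := Prod.snd) (fun _ _ => rfl)
      (fun w hw => ⟨by simpa using hw.1, Prod.ext hw.2.symm rfl⟩)
      (fun t ht => ⟨by simpa using ht, rfl⟩) (fun t ht u hu => by
        simp only [List.mem_filter, List.mem_finRange, true_and] at ht hu
        refine ⟨fun h => ⟨h, ?_⟩, fun h => h.1⟩
        simp only
        rw [add_assoc, ← Int.cast_add, F.volt_triangle s t ht u h hu])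
    exact ⟨ψ.trans φ⟩

theorem connected_cover : (F.cover d).Connected := by
  have h : ∀ n, (F.cover d).Reachable (coverPath d 0) (coverPath d n) := by
    intro n
    induction n with
    | zero => exact SimpleGraph.Reachable.refl _
    | succ n ih => exact ih.trans (F.adj_coverPath d n).reachable
  refine ⟨fun x y => ?_⟩
  rw [← coverPath_index d x, ← coverPath_index d y]
  exact (h _).symm.trans (h _)

theorem fNumber_zero_cover : (cliqueComplex (F.cover d)).fNumber 0 = d * m := by
  rw [fNumber_zero_cliqueComplex, Fintype.card_prod, ZMod.card, Fintype.card_fin]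

theorem two_mul_fNumber_one_cover : 2 * (cliqueComplex (F.cover d)).fNumber 1 =
    d * ∑ s, (Finset.univ.filter fun t => F.adj s t).card := by
  classical
  have hdeg : ∀ x, (F.cover d).degree x = (Finset.univ.filter fun t => F.adj x.2 t).card := by
    intro x
    rw [← SimpleGraph.card_neighborFinset_eq_degree]
    refine Finset.card_bij (fun y _ => y.2) (fun y hy => ?_) (fun y hy z hz hyz => ?_)
      fun t ht => ?_
    · rw [SimpleGraph.mem_neighborFinset] at hy
      simpa using hy.1
    · rw [SimpleGraph.mem_neighborFinset] at hy hz
      refine Prod.ext ?_ hyz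
      rw [hy.2, hz.2, hyz]
    · refine ⟨(x.1 + (F.volt x.2 t : ZMod d), t), ?_, rfl⟩
      rw [SimpleGraph.mem_neighborFinset]
      exact ⟨by simpa using ht, rfl⟩
  rw [two_mul_fNumber_one_cliqueComplex]
  simp only [hdeg]
  rw [Fintype.sum_prod_type]
  simp [ZMod.card]

end VoltageGraph

/-! ### Two explicit graphs -/

/-- The position, from `0` to `11`, of a vertex of the cycle with 32 vertices on the tube, which is a
stack leading from the octahedron around the edge `4, 10` to that around `18, 24`; the value `12`
stands for the vertices that are not on the tube. Each octahedron is listed with antipodes three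
steps apart. -/
def tubePosition : ℕ → ℕ
  | 9 => 0 | 10 => 1 | 8 => 2 | 6 => 3 | 4 => 4 | 5 => 5
  | 23 => 6 | 24 => 7 | 22 => 8 | 20 => 9 | 18 => 10 | 19 => 11
  | _ => 12

/-- Adjacency in a stack of octahedra: vertices are adjacent at the distances 1, 2, 4, 5, 6, the
binary digits of the constant. -/
def isNear (n : ℕ) : Bool := Nat.testBit 0b1110110 n

/-- The distance on the cycle with 32 vertices. -/
def cycleDist (s t : ℕ) : ℕ := min ((s + 32 - t) % 32) ((t + 32 - s) % 32)

/-- Two vertices of the tube are adjacent if they are near along the tube, any other two if they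
are near around the cycle. Within either end of the tube this removes just the edge between `4` and
`10`, or between `18` and `24`, since the ends of that edge are three steps apart on the tube. -/
def handleAdj (tube : Bool) (s t : Fin 32) : Bool :=
  bif tube && Nat.blt (tubePosition s) 12 && Nat.blt (tubePosition t) 12 then
    isNear (Nat.dist (tubePosition s) (tubePosition t))
  else isNear (cycleDist s t)

/-- An edge has voltage `1` if it passes the vertex `0` of the cycle upwards. Edges of the tube join
vertices at most `20` apart. -/
def handleVolt (s t : Fin 32) : ℤ :=
  bif Nat.ble (t + 26) s then 1 else bif Nat.ble (s + 26) t then -1 else 0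

/-- The number of times an edge passes the middle of the tube, from the first to the second
octahedron. -/
def tubeCross (s t : Fin 32) : ℤ :=
  bif Nat.blt (tubePosition s) 6 && (Nat.ble 6 (tubePosition t) && Nat.blt (tubePosition t) 12)
  then 1 else
  bif Nat.blt (tubePosition t) 6 && (Nat.ble 6 (tubePosition s) && Nat.blt (tubePosition s) 12)
  then -1 else 0

/-- Edges near around the cycle come first, then those across the tube, by increasing distance. -/
def handleRank (s t : Fin 32) : ℕ :=
  bif isNear (cycleDist s t) then cycleDist s t
  else 8 + Nat.dist (tubePosition s) (tubePosition t)

set_option maxRecDepth 10000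

/-- The flag triangulation of an `S²`-bundle over the circle by a cyclic stack of octahedra. -/
def stackGraph : VoltageGraph 32 0 where
  adj := handleAdj false
  volt := handleVolt
  cross := fun j => j.elim0
  tail := fun j => j.elim0
  head := fun j => j.elim0
  rank := handleRank
  adj_symm := by decide +kernel
  adj_self := by decide +kernel
  volt_antisymm := by decide +kernel
  volt_triangle := by decide +kernel
  cross_antisymm := fun j => j.elim0
  cross_triangle := fun j => j.elim0
  volt_eq_zero := fun j => j.elim0
  volt_eq_zero_of_triangle := fun j => j.elim0
  adj_succ := by decide +kernel
  volt_succ := by decide +kernel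
  cross_succ := fun j => j.elim0
  adj_chord := fun j => j.elim0
  cross_chord := fun j => j.elim0
  generate := by decide +kernel

/-- The stack of octahedra with a handle: two solid octahedra are removed, and their boundaries are
joined by a tube. -/
def handleGraph : VoltageGraph 32 1 where
  adj := handleAdj true
  volt := handleVolt
  cross := fun _ => tubeCross
  tail := fun _ => 5
  head := fun _ => 23
  rank := handleRank
  adj_symm := by decide +kernel
  adj_self := by decide +kernel
  volt_antisymm := by decide +kernel
  volt_triangle := by decide +kernel
  cross_antisymm := fun _ => by decide +kernel
  cross_triangle := fun _ => by decide +kernel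
  volt_eq_zero := fun _ => by decide +kernel
  volt_eq_zero_of_triangle := fun _ => by decide +kernel
  adj_succ := by decide +kernel
  volt_succ := by decide +kernel
  cross_succ := fun _ => by decide +kernel
  adj_chord := fun _ => by decide +kernel
  cross_chord := by decide +kernel
  generate := by decide +kernel

theorem reducesToOctahedron_link_handleAdj (tube : Bool) (s : Fin 32) :
    reducesToOctahedron 12 ((List.finRange 32).filter (handleAdj tube s)) (handleAdj tube) = true := by
  revert s
  cases tube <;> decide +kernel

theorem exists_four_clique_handleAdj (tube : Bool) : ∃ a b c e, handleAdj tube a b ∧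
    handleAdj tube a c ∧ handleAdj tube a e ∧ handleAdj tube b c ∧ handleAdj tube b e ∧
    handleAdj tube c e :=
  ⟨0, 1, 2, 6, by revert tube; decide +kernel⟩

theorem no_five_clique_handleAdj (tube : Bool) : ∀ a b, a < b → handleAdj tube a b →
    ∀ c, b < c → handleAdj tube a c → handleAdj tube b c →
    ∀ e, c < e → handleAdj tube a e → handleAdj tube b e → handleAdj tube c e →
    ∀ f, e < f → handleAdj tube a f → handleAdj tube b f → handleAdj tube c f →
      handleAdj tube e f → False := by
  cases tube <;> decide +kernel

theorem sum_degree_handleAdj (tube : Bool) :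
    ∑ s, (Finset.univ.filter fun t => handleAdj tube s t).card = bif tube then 352 else 320 := by
  revert tube
  decide +kernel

/-- The required properties of the covering, given those of the base graph. -/
theorem VoltageGraph.exists_complex {m r : ℕ} [NeZero m] (F : VoltageGraph m r) (d : ℕ) [NeZero d]
    {n b : ℕ}
    (hlink : ∀ s, reducesToOctahedron n ((List.finRange m).filter (F.adj s)) F.adj = true)
    (h4 : ∃ a b c e, F.adj a b ∧ F.adj a c ∧ F.adj a e ∧ F.adj b c ∧ F.adj b e ∧ F.adj c e)
    (h5 : ∀ a b, a < b → F.adj a b → ∀ c, b < c → F.adj a c → F.adj b c →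
      ∀ e, c < e → F.adj a e → F.adj b e → F.adj c e →
      ∀ f, e < f → F.adj a f → F.adj b f → F.adj c f → F.adj e f → False)
    (hdeg : ∑ s, (Finset.univ.filter fun t => F.adj s t).card = 2 * (5 * m + 16 * r))
    (hb : b = d * r + 1) :
    ∃ (V : Type) (_ : Fintype V) (_ : LinearOrder V) (K : AbstractSimplicialComplex V),
      K.IsFlag ∧ K.IsSimplicialManifold 3 ∧ ConnectedSpace K.realization ∧
      (∀ (k : Type*) [Field k], K.bettiNumber k 1 = b) ∧ K.bettiNumber ℤ 1 = b ∧
      K.gammaTwo = 16 * (b : ℤ) := by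
  subst hb
  refine ⟨ZMod d × Fin m, inferInstance,
    LinearOrder.lift' _ (Fintype.equivFin (ZMod d × Fin m)).injective, cliqueComplex (F.cover d),
    isFlag_cliqueComplex _, F.isSimplicialManifold_cover d hlink h4 h5,
    connectedSpace_realization_cliqueComplex (F.connected_cover d), fun k _ => ?_, ?_, ?_⟩
  · exact @bettiNumber_cover _ _ _ F d _ k _ _ (_)
  · exact @bettiNumber_cover _ _ _ F d _ ℤ _ _ (_)
  · have h := F.two_mul_fNumber_one_cover d
    rw [hdeg, ← mul_assoc, mul_comm d 2, mul_assoc] at h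
    have h' : (cliqueComplex (F.cover d)).fNumber 1 = d * (5 * m + 16 * r) := by omega
    rw [AbstractSimplicialComplex.gammaTwo, h', F.fNumber_zero_cover]
    push_cast
    ring

theorem mainTheorem5 (b : ℕ) (hb : 1 ≤ b) :
    ∃ (V : Type) (_ : Fintype V) (_ : LinearOrder V) (K : AbstractSimplicialComplex V),
      K.IsFlag ∧ K.IsSimplicialManifold 3 ∧ ConnectedSpace K.realization ∧
      (∀ (k : Type*) [Field k], K.bettiNumber k 1 = b) ∧ K.bettiNumber ℤ 1 = b ∧
      K.gammaTwo = 16 * (b : ℤ) := by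
  obtain rfl | hb' := hb.eq_or_lt
  · exact stackGraph.exists_complex 1 (reducesToOctahedron_link_handleAdj false)
      (exists_four_clique_handleAdj false) (no_five_clique_handleAdj false)
      (sum_degree_handleAdj false) rfl
  · have : NeZero (b - 1) := ⟨by omega⟩
    exact handleGraph.exists_complex (b - 1) (reducesToOctahedron_link_handleAdj true)
      (exists_four_clique_handleAdj true) (no_five_clique_handleAdj true)
      (sum_degree_handleAdj true) (by omega)
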